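/- **Setting.** Let $M=(\mathcal S,\mathcal A,\mathcal P,\mathcal R,\gamma,\rho)$ be a discounted MDP with finite state and action spaces, rewards $\mathcal R(s,a)\in[-\mathcal R_{\max},\mathcal R_{\max}]$, $\gamma\in[0,1)$ and an initial distribution with $\rho(s)>0$ for all $s$. For a stationary policy $\pi$ let $p(\cdot\mid\pi)$ be the law of $(s_0,a_0,s_1,a_1,\dots)$ with $s_0\sim\rho$, $a_t\sim\pi(\cdot\mid s_t)$, $s_{t+1}\sim\mathcal P(\cdot\mid s_t,a_t)$, and let $J(\pi)=\mathbb E_{p(\cdot\mid\pi)}\big[\sum_{t\ge0}\gamma^t\mathcal R(s_t,a_t)\big]$. Let $\pi_\theta(a\mid s)=e^{\theta_{s,a}}/\sum_{a'}e^{\theta_{s,a'}}$ for $\theta\in\mathbb R^{|\mathcal S||\mathcal A|}$, $J(\theta)=J(\pi_\theta)$, $J^*=\sup_\theta J(\theta)$. Let $\pi^*$ be any optimal policy, $d_{\rho,s}(\pi^*)=(1-\gamma)\sum_t\gamma^t\,\mathbb P_{\pi^*}(s_t=s)$ and $D=\|d_\rho(\pi^*)/\rho\|_\infty=\max_s d_{\rho,s}(\pi^*)/\rho(s)$.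 For $\lambda>0$ let $$L_\lambda(\theta)=J(\theta)+\frac{\lambda}{|\mathcal A||\mathcal S|}\sum_{s,a}\log\pi_\theta(a\mid s)+\lambda\log|\mathcal A|,\qquad L_\lambda^*=\sup_\theta L_\lambda(\theta).$$ *Vanilla PG* on $L_\lambda$ is $\theta_{t+1}=\theta_t+\eta\,\widehat\nabla_mL_\lambda(\theta_t)$, where $\widehat\nabla_mL_\lambda(\theta)=\frac1m\sum_{i=1}^m g(\tau_i\mid\theta)+\frac{\lambda}{|\mathcal A||\mathcal S|}\sum_{s,a}\nabla_\theta\log\pi_\theta(a\mid s)$, the $\tau_i$ are $m$ fresh independent trajectories of $\pi_{\theta}$ truncated after $H$ state-action pairs, and $g(\tau\mid\theta)$ is either the REINFORCE estimator $\sum_{t<H}\gamma^t\mathcal R(s_t,a_t)\cdot\sum_{t'<H}\nabla_\theta\log\pi_\theta(a_{t'}\mid s_{t'})$ or the GPOMDP estimator $\sum_{t<H}\gamma^t\mathcal R(s_t,a_t)\sum_{k\le t}\nabla_\theta\log\pi_\theta(a_k\mid s_k)$. *Exact PG* is $\theta_{t+1}=\theta_t+\eta\nabla L_\lambda(\theta_t)$.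 Given $\epsilon>0$, $\delta\in(0,1)$ and $\theta_0$, put $$\lambda=\frac{(1-\gamma)\epsilon}{2D},\quad \epsilon_{opt}=\frac{\lambda}{2|\mathcal S||\mathcal A|},\quad \delta_0=L_\lambda^*-L_\lambda(\theta_0),\quad L=\frac{\mathcal R_{\max}}{(1-\gamma)^2}\Big(2-\frac1{|\mathcal A|}\Big)+\frac{\lambda}{|\mathcal S|},$$ $\nu=2(1-\frac1{|\mathcal A|})\big(\frac{H\mathcal R_{\max}^2}{(1-\gamma)^2}+\frac{\lambda^2}{|\mathcal S|}\big)$ for REINFORCE and $\nu=2(1-\frac1{|\mathcal A|})\big(\frac{\mathcal R_{\max}^2}{(1-\gamma)^3}+\frac{\lambda^2}{|\mathcal S|}\big)$ for GPOMDP, and $\ell=\log\!\big(\tfrac4{1-\gamma}+\tfrac1{\epsilon_{opt}}\big)\big(1+\log\tfrac1\delta\big)$. **Statement.** There are constants $C,K>0$ depending only on $\mathcal R_{\max}$ such that for all such MDPs, $\pi^*$, $\epsilon$, $\theta_0$ the following hold. 1. *(High probability, vanilla PG.)* Let $\delta\in(0,1)$ and take either estimator. For all integers $H\ge C\ell/(1-\gamma)$,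 $1\le m\le\frac{2\nu}{\delta\epsilon_{opt}^2}$ and $T\ge1$ with $Tm\ge\frac{8\delta_0L\nu}{\delta^2\epsilon_{opt}^4}$, vanilla PG with step size $\eta=\frac{\delta\epsilon_{opt}^2m}{2L\nu}$ satisfies $\mathbb P(J^*-J(\theta_U)\le\epsilon)\ge1-\delta$, where $U$ is uniform on $\{0,\dots,T-1\}$ and independent of the iterates; moreover there is a deterministic $t_0<T$ with $\mathbb P(J^*-J(\theta_{t_0})\le\epsilon)\ge1-\delta$. If $|\mathcal A|\ge2$, then $\frac{2\nu}{\delta\epsilon_{opt}^2}\ge1$ for every $H$, so the range of $m$ is not empty. 2. *(Sample complexity.)* If moreover $\epsilon\le\frac1{1-\gamma}$, then with $H=\lceil C\ell/(1-\gamma)\rceil$, any such $m$, and $T=\max\{1,\lceil\frac{8\delta_0L\nu}{\delta^2\epsilon_{opt}^4m}\rceil\}$, the number of samples satisfies $$T\,m\,H\;\le\;K(1+\delta_0)\,\frac{|\mathcal S|^4|\mathcal A|^4D^4}{\delta^2\epsilon^4(1-\gamma)^{10}}\;\ell^{\,q},\qquad q=1\text{ for GPOMDP},\quad q=2\text{ for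 REINFORCE}.$$ 3. *(Exact PG.)* If $T\ge1$ and $T\ge\frac{12\delta_0L}{\epsilon_{opt}^2}$, then exact PG with step size $\eta=1/L$ satisfies $\min_{0\le t<T}J^*-J(\theta_t)\le\epsilon$; and if $\epsilon\le\frac1{1-\gamma}$, then $$\frac{12\delta_0L}{\epsilon_{opt}^2}\;\le\;K\,\frac{\delta_0\,|\mathcal S|^2|\mathcal A|^2D^2}{(1-\gamma)^4\epsilon^2}.$$ Thus the iteration bound is $O(\epsilon^{-2})$, and its factor $(1-\gamma)^{-4}$ improves by $1-\gamma$ on the $(1-\gamma)^{-5}$ given by a smoothness constant of order $(1-\gamma)^{-3}$. -/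

import Mathlib

open MeasureTheory ProbabilityTheory

universe u

noncomputable section

/-- A discounted Markov decision process with transition law `P`, reward `R`, discount factor `γ`
and initial state distribution `ρ`. -/
structure MDP (S A : Type u) where
  P : S → A → PMF S
  R : S → A → ℝ
  γ : ℝ
  ρ : PMF S
  γ_nonneg : 0 ≤ γ
  γ_lt_one : γ < 1

/-- The two truncated policy gradient estimators. -/
inductive Estimator where
  | reinforce
  | gpomdp

/-- The parameter space `ℝ^{|S||A|}` with its Euclidean norm. -/
abbrev Param (S A : Type u) [Fintype S] [Fintype A] := EuclideanSpace ℝ (S × A)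

section Softmax

variable {S A : Type u} [Fintype S] [Fintype A]

/-- The softmax probability `π_θ(a ∣ s)`. -/
def softmax (θ : Param S A) (s : S) (a : A) : ℝ :=
  Real.exp (θ (s, a)) / ∑ a', Real.exp (θ (s, a'))

theorem sum_ofReal_softmax [Nonempty A] (θ : Param S A) (s : S) :
    ∑ a, ENNReal.ofReal (softmax θ s a) = 1 := by
  have hpos : 0 < ∑ a', Real.exp (θ (s, a')) :=
    Finset.sum_pos (fun a _ => Real.exp_pos _) Finset.univ_nonempty
  rw [← ENNReal.ofReal_sum_of_nonneg]
  · simp only [softmax]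
    rw [← Finset.sum_div, div_self hpos.ne', ENNReal.ofReal_one]
  · intro a _
    exact div_nonneg (Real.exp_pos _).le hpos.le

/-- The softmax tabular policy `π_θ`. -/
def softmaxPolicy [Nonempty A] (θ : Param S A) (s : S) : PMF A :=
  PMF.ofFintype (fun a => ENNReal.ofReal (softmax θ s a)) (sum_ofReal_softmax θ s)

/-- The score `∇_θ log π_θ(a ∣ s)`. -/
def score (θ : Param S A) (s : S) (a : A) : Param S A :=
  gradient (fun θ' : Param S A => Real.log (softmax θ' s a)) θ

end Softmax

/-- `m` independent draws from a law on a finite type. -/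
def iidLaw {α : Type*} [Fintype α] (p : PMF α) (m : ℕ) : PMF (Fin m → α) :=
  PMF.ofFintype (fun x => ∏ i, p (x i)) (by
    classical
    have h1 : ∑ a, p a = 1 := by rw [← tsum_fintype (L := .unconditional α)]; exact p.tsum_coe
    have h := Finset.prod_univ_sum (fun _ : Fin m => (Finset.univ : Finset α)) (fun _ a => p a)
    rw [Fintype.piFinset_univ] at h
    rw [← h]
    simp [h1])

namespace MDP

variable {S A : Type u} [Fintype S] [Fintype A]
  [MeasurableSpace S] [MeasurableSingletonClass S]
  [MeasurableSpace A] [MeasurableSingletonClass A]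

section Policies

variable (M : MDP S A) (π : S → PMF A)

/-- Given a law for the current state, the joint law of the state and of the action that the
policy `π` takes there. -/
def withAction (q : PMF S) : PMF (S × A) :=
  q.bind fun s => (π s).map fun a => (s, a)

/-- The law of `(s_{n+1}, a_{n+1})` given `(s_0, a_0), …, (s_n, a_n)` under the policy `π`. -/
def stepKernel (n : ℕ) : Kernel (Finset.Iic n → S × A) (S × A) :=
  Kernel.ofFunOfCountable fun h =>
    (withAction π (M.P (h ⟨n, Finset.mem_Iic.2 le_rfl⟩).1
      (h ⟨n, Finset.mem_Iic.2 le_rfl⟩).2)).toMeasure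

instance (n : ℕ) : IsMarkovKernel (M.stepKernel π n) :=
  ⟨fun h => by
    change IsProbabilityMeasure (PMF.toMeasure _)
    infer_instance⟩

/-- The law `p(· ∣ π)` of the infinite trajectory `(s_0, a_0), (s_1, a_1), …`. -/
def trajLaw : Measure (ℕ → S × A) :=
  Kernel.trajMeasure (X := fun _ => S × A) (withAction π M.ρ).toMeasure (M.stepKernel π)

instance : IsProbabilityMeasure (M.trajLaw π) := by
  unfold trajLaw
  infer_instance

/-- The expected return `J(π)`, the mean of `∑ γ^t R(s_t, a_t)` over infinite trajectories. -/
def J : ℝ := ∫ τ, ∑' t : ℕ, M.γ ^ t * M.R (τ t).1 (τ t).2 ∂(M.trajLaw π)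

/-- `π` is an optimal policy. -/
def IsOptimal : Prop := ∀ π' : S → PMF A, M.J π' ≤ M.J π

/-- The discounted state visitation distribution `d_{ρ,s}(π)`. -/
def visitation (s : S) : ℝ :=
  (1 - M.γ) * ∑' t : ℕ, M.γ ^ t * (M.trajLaw π).real {τ | (τ t).1 = s}

/-- The distribution mismatch coefficient `‖d_ρ(π) / ρ‖_∞`. -/
def mismatch : ℝ := ⨆ s : S, M.visitation π s / (M.ρ s).toReal

/-- The first `H` state-action pairs of a trajectory. -/
def truncTraj {X : Type*} (H : ℕ) (τ : ℕ → X) (t : Fin H) : X := τ t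

theorem measurable_truncTraj {X : Type*} [MeasurableSpace X] (H : ℕ) :
    Measurable (truncTraj (X := X) H) :=
  measurable_pi_iff.2 fun t => measurable_pi_apply (t : ℕ)

/-- The law of the first `H` state-action pairs of a trajectory. -/
def truncLaw (H : ℕ) : PMF (Fin H → S × A) :=
  haveI : IsProbabilityMeasure ((M.trajLaw π).map (truncTraj H)) :=
    Measure.isProbabilityMeasure_map (measurable_truncTraj H).aemeasurable
  ((M.trajLaw π).map (truncTraj H)).toPMF

end Policies

variable [Nonempty A] (M : MDP S A)

/-- The optimal expected return `J^*` over the softmax policies. -/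
def Jstar : ℝ := ⨆ θ : Param S A, M.J (softmaxPolicy θ)

/-- The average over all state-action pairs of `log π_θ(a ∣ s)`, scaled by `lam`. -/
def _root_.logBarrier (lam : ℝ) (θ : Param S A) : ℝ :=
  lam / (Fintype.card A * Fintype.card S) * ∑ s : S, ∑ a : A, Real.log (softmax θ s a)

/-- The log barrier objective
`L_λ(θ) = J(θ) + λ / (|A||S|) ∑_{s,a} log π_θ(a ∣ s) + λ log |A|`,
that is `J(θ)` minus `λ` times the mean over `s` of `KL(Unif_A, π_θ(· ∣ s))`. -/
def barrierObj (lam : ℝ) (θ : Param S A) : ℝ :=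
  M.J (softmaxPolicy θ) + logBarrier lam θ + lam * Real.log (Fintype.card A)

/-- The initial gap `L_λ^* - L_λ(θ₀)`. -/
def barrierGap (lam : ℝ) (θ₀ : Param S A) : ℝ :=
  (⨆ θ : Param S A, M.barrierObj lam θ) - M.barrierObj lam θ₀

/-- The estimate of `∇J(θ)` from one truncated trajectory. -/
def trajGrad (e : Estimator) (θ : Param S A) {H : ℕ} (τ : Fin H → S × A) : Param S A :=
  match e with
  | .reinforce =>
      (∑ t : Fin H, M.γ ^ (t : ℕ) * M.R (τ t).1 (τ t).2) • ∑ t' : Fin H, score θ (τ t').1 (τ t').2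
  | .gpomdp =>
      ∑ t : Fin H, (M.γ ^ (t : ℕ) * M.R (τ t).1 (τ t).2) •
        ∑ k ∈ Finset.Iic t, score θ (τ k).1 (τ k).2

/-- The estimate of `∇L_λ(θ)` from a batch of `m` truncated trajectories. -/
def barrierGradEst (e : Estimator) (lam : ℝ) (θ : Param S A) {m H : ℕ}
    (b : Fin m → Fin H → S × A) : Param S A :=
  (1 / (m : ℝ)) • ∑ i, M.trajGrad e θ (b i) +
    (lam / (Fintype.card A * Fintype.card S)) • ∑ s : S, ∑ a : A, score θ s a

/-- The law of the iterate `θ_t` of vanilla policy gradient on `L_λ` with step size `η`: at each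
iteration a fresh batch of `m` independent trajectories of length `H` is sampled from `π_{θ_t}`. -/
def pgLaw (e : Estimator) (lam η : ℝ) (m H : ℕ) (θ₀ : Param S A) : ℕ → PMF (Param S A)
  | 0 => PMF.pure θ₀
  | t + 1 => (pgLaw e lam η m H θ₀ t).bind fun θ =>
      (iidLaw (M.truncLaw (softmaxPolicy θ) H) m).map fun b =>
        θ + η • M.barrierGradEst e lam θ b

/-- The probability that `J^* - J(θ_t) ≤ ε` for the iterate `θ_t` of vanilla policy gradient. -/
def successProb (e : Estimator) (lam η : ℝ) (m H : ℕ) (θ₀ : Param S A) (ε : ℝ) (t : ℕ) : ℝ :=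
  ((M.pgLaw e lam η m H θ₀ t).toOuterMeasure
    {θ | M.Jstar - M.J (softmaxPolicy θ) ≤ ε}).toReal

/-- The iterates of exact policy gradient on `L_λ` with step size `η`. -/
def exactPG (lam η : ℝ) (θ₀ : Param S A) : ℕ → Param S A
  | 0 => θ₀
  | t + 1 => exactPG lam η θ₀ t + η • gradient (M.barrierObj lam) (exactPG lam η θ₀ t)

end MDP

/-- The smoothness constant `L` of `L_λ`, for `nS` states and `nA` actions. -/
def smoothConst (Rmax γ lam nS nA : ℝ) : ℝ :=
  Rmax / (1 - γ) ^ 2 * (2 - 1 / nA) + lam / nS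

/-- The second moment constant `ν` of the gradient estimator with horizon `H`. -/
def nuConst (e : Estimator) (Rmax γ lam nS nA : ℝ) (H : ℕ) : ℝ :=
  match e with
  | .reinforce => 2 * (1 - 1 / nA) * (H * Rmax ^ 2 / (1 - γ) ^ 2 + lam ^ 2 / nS)
  | .gpomdp => 2 * (1 - 1 / nA) * (Rmax ^ 2 / (1 - γ) ^ 3 + lam ^ 2 / nS)

/-- The exponent of the logarithmic factor in the sample complexity; the constant `ν` of REINFORCE
carries one more factor `H` than that of GPOMDP. -/
def Estimator.logExp : Estimator → ℕ
  | .reinforce => 2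
  | .gpomdp => 1

end

/-! Smoothness, an unbiased estimate of a truncated gradient and a gradient domination property are
combined.

Smoothness. A path probability is a policy-free factor times a product of softmax probabilities, so
the mean of the reward at time `t` is a finite sum that can be differentiated twice along any line.
The second derivative involves the score variances and the squared sum of `t + 1` scores. The scores
are martingale differences with second moment at most `1 - 1/|A|`, so the squared sum costs `t + 1`
and not `(t + 1)^2` (`abs_stepExp_sub_sub_le`). Summing `(t + 1) γ^t` gives a smoothness constant of
order `(1 - γ)⁻²`, one power better than the usual one; the log barrier adds `λ/|S|`.

Estimators. REINFORCE and GPOMDP are both unbiased for the gradient of the `H`-step return; the same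
orthogonality bounds their second moments by `ν/2`. The bias relative to the full gradient decays
like `γ^H` up to a factor linear in `H`, so a logarithmic multiple of `1/(1 - γ)` steps suffices.

Gradient domination. By performance difference, coordinate `(s, a)` of `∇J` is the discounted
occupation of `s` times `π_θ(a ∣ s)` times the advantage. If `‖∇L_λ‖ ≤ λ/(|A||S|)`, the barrier
keeps `π_θ(a ∣ s)` from hiding a positive advantage: every advantage is at most `λ/(|S| ρ(s))`.
Weighting by the occupation of `π*` yields a gap of at most `λD/(1 - γ) = ε/2`
(`J_sub_J_le_of_norm_objGrad_le`).

Conclusion. Telescoping the one-step ascent inequality bounds the mean of `‖∇L_λ(θ_t)‖²` over time.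
Markov's inequality at each `t`, at level `εopt²`, bounds the average failure probability by `δ`;
the gap takes half of the budget, the noise and the bias a quarter each. Some index does at least as
well as the average. Exact ascent is the case without noise and bias. -/

noncomputable section

/-! ### Laws of finite paths and expectations under them -/

namespace MDP

theorem withAction_apply {S A : Type u} (π : S → PMF A) (q : PMF S) (x : S × A) :
    withAction π q x = q x.1 * π x.1 x.2 := by
  classical
  obtain ⟨s, a⟩ := x
  rw [withAction, PMF.bind_apply, tsum_eq_single s]
  · rw [PMF.map_apply, tsum_eq_single a]
    · simp
    · intro b hb
      simp [Ne.symm hb]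
  · intro s' hs
    rw [PMF.map_apply]
    simp [Ne.symm hs]

/-- The law of the state that follows a finite path. -/
def nextState {S A : Type u} (M : MDP S A) : {n : ℕ} → (Fin n → S × A) → PMF S
  | 0, _ => M.ρ
  | n + 1, τ => M.P (τ (Fin.last n)).1 (τ (Fin.last n)).2

section Paths

variable {S A : Type u} [Fintype S] [Fintype A]
  [MeasurableSpace S] [MeasurableSingletonClass S]
  [MeasurableSpace A] [MeasurableSingletonClass A]
  (M : MDP S A) (π : S → PMF A)

theorem truncLaw_apply (H : ℕ) (τ : Fin H → S × A) :
    M.truncLaw π H τ = M.trajLaw π {ω | truncTraj H ω = τ} := by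
  rw [truncLaw, Measure.toPMF_apply, Measure.map_apply (measurable_truncTraj H)
    (measurableSet_singleton τ)]
  rfl

theorem trajLaw_map_frestrictLe_zero :
    (M.trajLaw π).map (Preorder.frestrictLe 0) =
      (withAction π M.ρ).toMeasure.map
        (MeasurableEquiv.piUnique (fun _ : Finset.Iic 0 => S × A)).symm := by
  rw [trajLaw, Kernel.trajMeasure, Measure.map_comp _ _ (by fun_prop),
    Kernel.traj_map_frestrictLe, Kernel.partialTraj_self, Measure.id_comp]

theorem trajLaw_zero (x : S × A) :
    M.trajLaw π {ω | ω 0 = x} = M.ρ x.1 * π x.1 x.2 := by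
  have h := congrArg (fun μ => μ {y | y ⟨0, by simp⟩ = x}) (M.trajLaw_map_frestrictLe_zero π)
  have hm : MeasurableSet {y : Finset.Iic 0 → S × A | y ⟨0, by simp⟩ = x} :=
    measurableSet_eq_fun (measurable_pi_apply _) measurable_const
  rw [Measure.map_apply (by fun_prop) hm, Measure.map_apply (by fun_prop) hm] at h
  rw [← withAction_apply, ← PMF.toMeasure_apply_singleton _ _ (measurableSet_singleton x)]
  exact h

theorem trajLaw_succ (n : ℕ) (h : Finset.Iic n → S × A) (x : S × A) :
    M.trajLaw π {ω | Preorder.frestrictLe n ω = h ∧ ω (n + 1) = x} =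
      M.trajLaw π {ω | Preorder.frestrictLe n ω = h} *
        (M.P (h ⟨n, Finset.mem_Iic.2 le_rfl⟩).1 (h ⟨n, Finset.mem_Iic.2 le_rfl⟩).2 x.1 *
          π x.1 x.2) := by
  have key : (M.trajLaw π).map (Preorder.frestrictLe n) ⊗ₘ M.stepKernel π n =
      (M.trajLaw π).map (fun x ↦ (Preorder.frestrictLe n x, x (n + 1))) :=
    Kernel.map_frestrictLe_trajMeasure_compProd_eq_map_trajMeasure
  have h2 := congrArg (fun μ => μ ({h} ×ˢ {x})) key
  rw [Measure.compProd_apply_prod (measurableSet_singleton h) (measurableSet_singleton x),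
    Measure.map_apply (by fun_prop)
      ((measurableSet_singleton h).prod (measurableSet_singleton x)), lintegral_singleton,
    Measure.map_apply (by fun_prop) (measurableSet_singleton h)] at h2
  rw [← withAction_apply, ← PMF.toMeasure_apply_singleton _ _ (measurableSet_singleton x),
    mul_comm]
  exact h2.symm

/-- The Markov recursion from which finite-path expectations are computed. Since `nextState` of the
empty path is `ρ`, the initial pair needs no separate formula. -/
theorem truncLaw_succ (n : ℕ) (τ : Fin n → S × A) (x : S × A) :
    M.truncLaw π (n + 1) (Fin.snoc (α := fun _ => S × A) τ x) =
      M.truncLaw π n τ * (M.nextState τ x.1 * π x.1 x.2) := by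
  rw [truncLaw_apply, truncLaw_apply]
  cases n with
  | zero =>
    have h1 : {ω : ℕ → S × A | truncTraj 0 ω = τ} = Set.univ :=
      Set.eq_univ_of_forall fun ω => Subsingleton.elim _ _
    have h2 : {ω : ℕ → S × A | truncTraj (0 + 1) ω = Fin.snoc (α := fun _ => S × A) τ x} =
        {ω | ω 0 = x} := by
      ext ω
      simp only [Set.mem_ofPred_eq, funext_iff, Fin.forall_fin_one, Nat.reduceAdd]
      rfl
    rw [h1, h2, measure_univ, one_mul, trajLaw_zero]
    rfl
  | succ n =>
    have h1 : ∀ ω : ℕ → S × A, truncTraj (n + 1) ω = τ ↔ Preorder.frestrictLe n ω =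
        fun i : Finset.Iic n => τ ⟨i, Nat.lt_succ_of_le (Finset.mem_Iic.1 i.2)⟩ := by
      intro ω
      simp only [funext_iff, truncTraj, Preorder.frestrictLe_apply]
      exact ⟨fun h i => h ⟨i, _⟩, fun h i => h ⟨i, Finset.mem_Iic.2 (Nat.le_of_lt_succ i.2)⟩⟩
    have h2 : {ω : ℕ → S × A | truncTraj (n + 1 + 1) ω = Fin.snoc (α := fun _ => S × A) τ x} =
        {ω | Preorder.frestrictLe n ω =
          (fun i : Finset.Iic n => τ ⟨i, Nat.lt_succ_of_le (Finset.mem_Iic.1 i.2)⟩) ∧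
            ω (n + 1) = x} := by
      ext ω
      rw [Set.mem_ofPred_eq, Set.mem_ofPred_eq, ← h1]
      simp only [funext_iff, Fin.forall_fin_succ' (n := n + 1), Fin.snoc_castSucc, Fin.snoc_last]
      rfl
    rw [h2, trajLaw_succ]
    simp only [h1]
    rfl

/-- The mean of a function of the first `H` state-action pairs. -/
def pathExp (H : ℕ) {E : Type*} [AddCommGroup E] [Module ℝ E] (F : (Fin H → S × A) → E) : E :=
  ∑ τ, (M.truncLaw π H τ).toReal • F τ

theorem integral_truncTraj (H : ℕ) {E : Type*} [NormedAddCommGroup E] [NormedSpace ℝ E]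
    [CompleteSpace E] (F : (Fin H → S × A) → E) :
    ∫ ω, F (truncTraj H ω) ∂(M.trajLaw π) = M.pathExp π H F := by
  have h := integral_map (μ := M.trajLaw π) (φ := truncTraj (X := S × A) H)
    (measurable_truncTraj H).aemeasurable (f := F)
    (StronglyMeasurable.of_discrete (f := F)).aestronglyMeasurable
  have : IsProbabilityMeasure ((M.trajLaw π).map (truncTraj (X := S × A) H)) :=
    Measure.isProbabilityMeasure_map (measurable_truncTraj H).aemeasurable
  rw [← h, integral_fintype Integrable.of_finite, pathExp]
  refine Finset.sum_congr rfl fun τ _ => ?_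
  rw [truncLaw, Measure.toPMF_apply, Measure.real]

theorem sum_toReal_pmf {α : Type*} [Fintype α] (p : PMF α) : ∑ a, (p a).toReal = 1 := by
  rw [← ENNReal.toReal_sum fun a _ => p.apply_ne_top a, ← tsum_fintype (L := .unconditional α),
    p.tsum_coe, ENNReal.toReal_one]

theorem pathExp_succ (n : ℕ) {E : Type*} [AddCommGroup E] [Module ℝ E]
    (F : (Fin (n + 1) → S × A) → E) :
    M.pathExp π (n + 1) F = M.pathExp π n fun τ =>
      ∑ s, (M.nextState τ s).toReal • ∑ a, (π s a).toReal •
        F (Fin.snoc (α := fun _ => S × A) τ (s, a)) := by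
  classical
  rw [pathExp, pathExp, ← (Fin.snocEquiv fun _ => S × A).sum_comp, Fintype.sum_prod_type_right]
  refine Finset.sum_congr rfl fun τ _ => ?_
  rw [Fintype.sum_prod_type, Finset.smul_sum]
  refine Finset.sum_congr rfl fun s _ => ?_
  rw [Finset.smul_sum, Finset.smul_sum]
  refine Finset.sum_congr rfl fun a _ => ?_
  rw [show Fin.snocEquiv (fun _ => S × A) ((s, a), τ) = Fin.snoc (α := fun _ => S × A) τ (s, a)
    from rfl, truncLaw_succ, ENNReal.toReal_mul, ENNReal.toReal_mul, mul_smul,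
    mul_smul]

section Algebra

variable {H : ℕ} {E : Type*} [AddCommGroup E] [Module ℝ E]

theorem pathExp_add (F G : (Fin H → S × A) → E) :
    M.pathExp π H (fun τ => F τ + G τ) = M.pathExp π H F + M.pathExp π H G := by
  simp only [pathExp, smul_add, Finset.sum_add_distrib]

theorem pathExp_sum {ι : Type*} (s : Finset ι) (F : ι → (Fin H → S × A) → E) :
    M.pathExp π H (fun τ => ∑ i ∈ s, F i τ) = ∑ i ∈ s, M.pathExp π H (F i) := by
  simp only [pathExp, Finset.smul_sum]
  exact Finset.sum_comm

theorem pathExp_smul (c : ℝ) (F : (Fin H → S × A) → E) :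
    M.pathExp π H (fun τ => c • F τ) = c • M.pathExp π H F := by
  simp only [pathExp, Finset.smul_sum, smul_comm c]

theorem pathExp_mul (c : ℝ) (F : (Fin H → S × A) → ℝ) :
    M.pathExp π H (fun τ => c * F τ) = c * M.pathExp π H F :=
  M.pathExp_smul π c F

theorem pathExp_const (c : E) : M.pathExp π H (fun _ => c) = c := by
  rw [pathExp, ← Finset.sum_smul, sum_toReal_pmf, one_smul]

theorem pathExp_zero_right : M.pathExp π H (fun _ => (0 : E)) = 0 := M.pathExp_const π 0

end Algebra

theorem pathExp_mono {H : ℕ} {F G : (Fin H → S × A) → ℝ} (h : ∀ τ, F τ ≤ G τ) :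
    M.pathExp π H F ≤ M.pathExp π H G :=
  Finset.sum_le_sum fun τ _ => mul_le_mul_of_nonneg_left (h τ) ENNReal.toReal_nonneg

theorem norm_pathExp_le {H : ℕ} {E : Type*} [NormedAddCommGroup E] [NormedSpace ℝ E]
    (F : (Fin H → S × A) → E) : ‖M.pathExp π H F‖ ≤ M.pathExp π H fun τ => ‖F τ‖ := by
  refine (norm_sum_le _ _).trans_eq (Finset.sum_congr rfl fun τ _ => ?_)
  rw [norm_smul, Real.norm_of_nonneg ENNReal.toReal_nonneg, smul_eq_mul]

theorem inner_pathExp {H : ℕ} {E : Type*} [NormedAddCommGroup E] [InnerProductSpace ℝ E]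
    (F : (Fin H → S × A) → E) (v : E) :
    inner ℝ (M.pathExp π H F) v = M.pathExp π H fun τ => inner ℝ (F τ) v := by
  simp only [pathExp, sum_inner, real_inner_smul_left, smul_eq_mul]

/-- Consistency of the marginals: both sides integrate the same function against the law of infinite
trajectories. -/
theorem pathExp_castLE {n H : ℕ} (h : n ≤ H) {E : Type*} [NormedAddCommGroup E] [NormedSpace ℝ E]
    [CompleteSpace E] (F : (Fin n → S × A) → E) :
    M.pathExp π H (fun τ => F fun i => τ (Fin.castLE h i)) = M.pathExp π n F := by
  rw [← integral_truncTraj, ← integral_truncTraj]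
  rfl

/-- The factor `c` collects the initial and transition probabilities. It is chosen before `π`, so
differentiation in the policy parameters touches only the product. -/
theorem exists_truncLaw_eq_prod (H : ℕ) :
    ∃ c : (Fin H → S × A) → ℝ, ∀ (π : S → PMF A) (τ : Fin H → S × A),
      (M.truncLaw π H τ).toReal = c τ * ∏ t, (π (τ t).1 (τ t).2).toReal := by
  induction H with
  | zero =>
    refine ⟨fun _ => 1, fun π τ => ?_⟩
    have := sum_toReal_pmf (M.truncLaw π 0)
    rw [Fintype.sum_subsingleton _ τ] at this
    simp [this]
  | succ n ih =>
    obtain ⟨c, hc⟩ := ih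
    refine ⟨fun τ => c (Fin.init τ) * (M.nextState (Fin.init τ) (τ (Fin.last n)).1).toReal,
      fun π τ => ?_⟩
    have h := M.truncLaw_succ π n (Fin.init τ) (τ (Fin.last n))
    rw [Fin.snoc_init_self] at h
    rw [h, ENNReal.toReal_mul, ENNReal.toReal_mul, hc, Fin.prod_univ_castSucc]
    simp only [Fin.init]
    ring

/-- The mean of `f (s_t, a_t)`. -/
def stepExp (t : ℕ) (f : S × A → ℝ) : ℝ := M.pathExp π (t + 1) fun τ => f (τ (Fin.last t))

theorem integral_apply (t : ℕ) (f : S × A → ℝ) :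
    ∫ ω, f (ω t) ∂(M.trajLaw π) = M.stepExp π t f :=
  M.integral_truncTraj π (t + 1) fun τ => f (τ (Fin.last t))

theorem pathExp_apply {H : ℕ} (t : Fin H) (f : S × A → ℝ) :
    M.pathExp π H (fun τ => f (τ t)) = M.stepExp π t f :=
  M.pathExp_castLE π (n := t + 1) (H := H) t.2 fun τ => f (τ (Fin.last t))

theorem abs_stepExp_le (t : ℕ) {f : S × A → ℝ} {B : ℝ} (hf : ∀ x, |f x| ≤ B) :
    |M.stepExp π t f| ≤ B :=
  (M.norm_pathExp_le π fun τ : Fin (t + 1) → S × A => f (τ (Fin.last t))).trans <|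
    (M.pathExp_mono π fun τ => hf (τ (Fin.last t))).trans_eq (M.pathExp_const π B)

theorem stepExp_zero (f : S × A → ℝ) :
    M.stepExp π 0 f = ∑ s, (M.ρ s).toReal * ∑ a, (π s a).toReal * f (s, a) := by
  rw [stepExp, pathExp_succ]
  simp only [Fin.snoc_last, smul_eq_mul]
  exact M.pathExp_const π (H := 0)
    (∑ s, (M.ρ s).toReal * ∑ a, (π s a).toReal * f (s, a))

theorem stepExp_succ (t : ℕ) (f : S × A → ℝ) :
    M.stepExp π (t + 1) f = M.stepExp π t fun x =>
      ∑ s, (M.P x.1 x.2 s).toReal * ∑ a, (π s a).toReal * f (s, a) := by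
  rw [stepExp, pathExp_succ]
  simp only [Fin.snoc_last, smul_eq_mul]
  rfl

theorem exists_abs_le {α : Type*} [Finite α] (f : α → ℝ) : ∃ B, ∀ x, |f x| ≤ B := by
  obtain ⟨B, hB⟩ := (Set.finite_range fun x => |f x|).bddAbove
  exact ⟨B, fun x => hB ⟨x, rfl⟩⟩

theorem summable_stepExp (f : S × A → ℝ) : Summable fun t => M.γ ^ t * M.stepExp π t f := by
  obtain ⟨B, hB⟩ := exists_abs_le f
  refine Summable.of_norm_bounded
    ((summable_geometric_of_lt_one M.γ_nonneg M.γ_lt_one).mul_right B) fun t => ?_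
  rw [norm_mul, Real.norm_of_nonneg (pow_nonneg M.γ_nonneg t)]
  exact mul_le_mul_of_nonneg_left (M.abs_stepExp_le π t hB) (pow_nonneg M.γ_nonneg t)

theorem J_eq_tsum : M.J π = ∑' t, M.γ ^ t * M.stepExp π t fun x => M.R x.1 x.2 := by
  obtain ⟨B, hB⟩ := exists_abs_le fun x : S × A => M.R x.1 x.2
  have hint : ∀ t : ℕ, Integrable (fun ω : ℕ → S × A => M.γ ^ t * M.R (ω t).1 (ω t).2)
      (M.trajLaw π) := fun t => by
    refine Integrable.const_mul (Integrable.of_bound (C := B) ?_ ?_) _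
    · exact ((StronglyMeasurable.of_discrete (f := fun x : S × A => M.R x.1 x.2)).comp_measurable
        (measurable_pi_apply t)).aestronglyMeasurable
    · exact ae_of_all _ fun ω => hB (ω t)
  rw [J, ← integral_tsum_of_summable_integral_norm hint]
  · simp only [integral_const_mul]
    exact tsum_congr fun t => congrArg _ (M.integral_apply π t fun x => M.R x.1 x.2)
  · refine Summable.of_nonneg_of_le (fun t => integral_nonneg fun ω => norm_nonneg _) (fun t => ?_)
      ((summable_geometric_of_lt_one M.γ_nonneg M.γ_lt_one).mul_right B)
    refine (integral_mono_of_nonneg (ae_of_all _ fun ω => norm_nonneg _)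
      (integrable_const (M.γ ^ t * B)) (ae_of_all _ fun ω => ?_)).trans_eq (by simp)
    simp only [norm_mul, Real.norm_of_nonneg (pow_nonneg M.γ_nonneg t)]
    exact mul_le_mul_of_nonneg_left (hB (ω t)) (pow_nonneg M.γ_nonneg t)

theorem abs_J_le {B : ℝ} (hB : ∀ s a, |M.R s a| ≤ B) : |M.J π| ≤ B / (1 - M.γ) := by
  rw [← Real.norm_eq_abs, J_eq_tsum, div_eq_inv_mul,
    ← tsum_geometric_of_lt_one M.γ_nonneg M.γ_lt_one,
    ← tsum_mul_right]
  refine tsum_of_norm_bounded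
    ((summable_geometric_of_lt_one M.γ_nonneg M.γ_lt_one).mul_right B).hasSum fun t => ?_
  rw [norm_mul, Real.norm_of_nonneg (pow_nonneg M.γ_nonneg t)]
  exact mul_le_mul_of_nonneg_left (M.abs_stepExp_le π t fun x => hB x.1 x.2)
    (pow_nonneg M.γ_nonneg t)

/-- The same decision process with another reward. -/
def withReward (r : S → A → ℝ) : MDP S A := { M with R := r }

theorem J_withReward (r : S → A → ℝ) :
    (M.withReward r).J π = ∑' t, M.γ ^ t * M.stepExp π t fun x => r x.1 x.2 :=
  (M.withReward r).J_eq_tsum π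

theorem trajLaw_real_eq [DecidableEq S] (t : ℕ) (s : S) :
    (M.trajLaw π).real {ω | (ω t).1 = s} =
      M.stepExp π t fun x => if x.1 = s then 1 else 0 := by
  rw [← integral_apply]
  have hm : MeasurableSet {ω : ℕ → S × A | (ω t).1 = s} :=
    measurableSet_eq_fun ((measurable_fst).comp (measurable_pi_apply t)) measurable_const
  rw [← integral_indicator_one hm]
  refine integral_congr_ae (ae_of_all _ fun ω => ?_)
  by_cases h : (ω t).1 = s <;> simp [Set.indicator, h]

theorem visitation_eq_tsum [DecidableEq S] (s : S) :
    M.visitation π s =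
      (1 - M.γ) * ∑' t, M.γ ^ t * M.stepExp π t fun x => if x.1 = s then 1 else 0 := by
  simp only [visitation, trajLaw_real_eq]

end Paths
end MDP

/-! ### Moments and derivatives of the softmax scores -/

section SoftmaxCalculus

variable {S A : Type u} [Fintype S] [Fintype A] [Nonempty A]

theorem sum_exp_pos (θ : Param S A) (s : S) : 0 < ∑ a, Real.exp (θ (s, a)) :=
  Finset.sum_pos (fun _ _ => Real.exp_pos _) Finset.univ_nonempty

theorem softmax_pos (θ : Param S A) (s : S) (a : A) : 0 < softmax θ s a :=
  div_pos (Real.exp_pos _) (sum_exp_pos θ s)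

theorem sum_softmax (θ : Param S A) (s : S) : ∑ a, softmax θ s a = 1 := by
  simp only [softmax, ← Finset.sum_div]
  exact div_self (sum_exp_pos θ s).ne'

theorem softmax_le_one (θ : Param S A) (s : S) (a : A) : softmax θ s a ≤ 1 := by
  rw [← sum_softmax θ s]
  exact Finset.single_le_sum (f := softmax θ s) (fun b _ => (softmax_pos θ s b).le)
    (Finset.mem_univ a)

theorem toReal_softmaxPolicy (θ : Param S A) (s : S) (a : A) :
    (softmaxPolicy θ s a).toReal = softmax θ s a := by
  rw [softmaxPolicy, PMF.ofFintype_apply, ENNReal.toReal_ofReal (softmax_pos θ s a).le]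

theorem log_softmax (θ : Param S A) (s : S) (a : A) :
    Real.log (softmax θ s a) = θ (s, a) - Real.log (∑ a', Real.exp (θ (s, a'))) := by
  rw [softmax, Real.log_div (Real.exp_ne_zero _) (sum_exp_pos θ s).ne', Real.log_exp]

theorem hasFDerivAt_log_softmax (θ : Param S A) (s : S) (a : A) :
    HasFDerivAt (fun θ' : Param S A => Real.log (softmax θ' s a))
      ((EuclideanSpace.proj (s, a) : Param S A →L[ℝ] ℝ) -
        ∑ a', softmax θ s a' • (EuclideanSpace.proj (s, a') : Param S A →L[ℝ] ℝ)) θ := by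
  have hp : ∀ b : A, HasFDerivAt (fun θ' : Param S A => θ' (s, b))
      (EuclideanSpace.proj (s, b) : Param S A →L[ℝ] ℝ) θ := fun b =>
    (EuclideanSpace.proj (s, b) : Param S A →L[ℝ] ℝ).hasFDerivAt
  have h := (hp a).fun_sub ((HasFDerivAt.fun_sum fun b (_ : b ∈ Finset.univ) => (hp b).exp).log
    (sum_exp_pos θ s).ne')
  simp only [log_softmax]
  refine h.congr_fderiv ?_
  rw [Finset.smul_sum]
  refine congrArg _ (Finset.sum_congr rfl fun b _ => ?_)
  rw [smul_smul, softmax, div_eq_inv_mul]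

theorem inner_score (θ : Param S A) (s : S) (a : A) (v : Param S A) :
    inner ℝ (score θ s a) v = v (s, a) - ∑ a', softmax θ s a' * v (s, a') := by
  rw [score, inner_gradient_left, (hasFDerivAt_log_softmax θ s a).fderiv]
  simp

theorem score_apply [DecidableEq S] [DecidableEq A] (θ : Param S A) (s : S) (a : A) (s' : S)
    (a' : A) :
    score θ s a (s', a') =
      if s' = s then (if a' = a then 1 else 0) - softmax θ s a' else 0 := by
  have h := inner_score θ s a (EuclideanSpace.single (s', a') (1 : ℝ))
  rw [EuclideanSpace.inner_single_right] at h
  simp only [one_mul, conj_trivial, PiLp.single_apply, Prod.mk.injEq] at h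
  rw [h]
  by_cases hs : s' = s
  · subst hs
    simp [eq_comm]
  · simp [hs, Ne.symm hs]

theorem sum_softmax_smul_score (θ : Param S A) (s : S) : ∑ a, softmax θ s a • score θ s a = 0 := by
  refine ext_inner_right ℝ fun v => ?_
  simp only [sum_inner, real_inner_smul_left, inner_score, inner_zero_left, mul_sub,
    Finset.sum_sub_distrib, ← Finset.sum_mul, sum_softmax, one_mul, sub_self]

theorem inv_card_le_sum_softmax_sq (θ : Param S A) (s : S) :
    1 / (Fintype.card A : ℝ) ≤ ∑ a, softmax θ s a ^ 2 := by
  have h := sq_sum_le_card_mul_sum_sq (s := Finset.univ) (f := softmax θ s)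
  rw [sum_softmax, one_pow, Finset.card_univ] at h
  rwa [div_le_iff₀' (by exact_mod_cast Fintype.card_pos)]

/-- Writing `p` for the action probabilities, the squared norm of the score at `a` is `1 - 2 p_a + ∑
p²`, with mean `1 - ∑ p²`; Cauchy-Schwarz gives `∑ p² ≥ 1/|A|`. -/
theorem sum_softmax_mul_norm_score_sq_le (θ : Param S A) (s : S) :
    ∑ a, softmax θ s a * ‖score θ s a‖ ^ 2 ≤ 1 - 1 / (Fintype.card A : ℝ) := by
  classical
  have h : ∀ a, ‖score θ s a‖ ^ 2 =
      1 - 2 * softmax θ s a + ∑ a', softmax θ s a' ^ 2 := fun a => by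
    rw [← real_inner_self_eq_norm_sq, inner_score]
    simp only [score_apply, if_true, mul_sub, Finset.sum_sub_distrib, mul_ite, mul_one, mul_zero,
      Finset.sum_ite_eq', Finset.mem_univ, sq]
    ring
  simp only [h, mul_add, mul_sub, Finset.sum_add_distrib, Finset.sum_sub_distrib,
    ← Finset.sum_mul, sum_softmax, one_mul, mul_one]
  have h2 : ∑ a, softmax θ s a * (2 * softmax θ s a) = 2 * ∑ a, softmax θ s a ^ 2 := by
    rw [Finset.mul_sum]
    exact Finset.sum_congr rfl fun a _ => by ring
  linarith [inv_card_le_sum_softmax_sq θ s]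

/-- The variance of the direction `v` under `π_θ(· ∣ s)`. -/
def dirVar (θ v : Param S A) (s : S) : ℝ :=
  ∑ a, softmax θ s a * inner ℝ (score θ s a) v ^ 2

theorem dirVar_nonneg (θ v : Param S A) (s : S) : 0 ≤ dirVar θ v s :=
  Finset.sum_nonneg fun a _ => mul_nonneg (softmax_pos θ s a).le (sq_nonneg _)

theorem dirVar_le (θ v : Param S A) (s : S) :
    dirVar θ v s ≤ (1 - 1 / (Fintype.card A : ℝ)) * ‖v‖ ^ 2 := by
  refine le_trans ?_ (mul_le_mul_of_nonneg_right (sum_softmax_mul_norm_score_sq_le θ s)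
    (sq_nonneg _))
  rw [dirVar, Finset.sum_mul]
  refine Finset.sum_le_sum fun a _ => ?_
  rw [mul_assoc, ← mul_pow]
  refine mul_le_mul_of_nonneg_left ?_ (softmax_pos θ s a).le
  rw [← sq_abs]
  exact pow_le_pow_left₀ (abs_nonneg _) (abs_real_inner_le_norm _ _) 2

/-- Scores have mean zero, so the centring of one of the two factors can be dropped. This is the
form in which the variance arises as a derivative. -/
theorem dirVar_eq (θ v : Param S A) (s : S) :
    dirVar θ v s = ∑ a, softmax θ s a * inner ℝ (score θ s a) v * v (s, a) := by
  have h0 : ∑ a, softmax θ s a * inner ℝ (score θ s a) v = 0 := by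
    have h := congrArg (fun w => inner ℝ w v) (sum_softmax_smul_score θ s)
    simpa only [sum_inner, real_inner_smul_left, inner_zero_left] using h
  have h1 : ∑ a, softmax θ s a * inner ℝ (score θ s a) v *
      ∑ a', softmax θ s a' * v (s, a') = 0 := by
    rw [← Finset.sum_mul, h0, zero_mul]
  rw [dirVar, ← sub_zero (∑ a, softmax θ s a * _ * v (s, a)), ← h1, ← Finset.sum_sub_distrib]
  refine Finset.sum_congr rfl fun a _ => ?_
  rw [← mul_sub, ← inner_score]
  ring

/-- A variance is at most a second moment. Unlike `dirVar_le`, the bound sees only the coordinates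
of `s`, so its sum over states is `‖v‖²` and not `|S| ‖v‖²`. -/
theorem dirVar_le_sum_sq (θ v : Param S A) (s : S) : dirVar θ v s ≤ ∑ a, v (s, a) ^ 2 := by
  have h : dirVar θ v s =
      ∑ a, softmax θ s a * v (s, a) ^ 2 - (∑ a, softmax θ s a * v (s, a)) ^ 2 := by
    rw [dirVar_eq, sq, Finset.sum_mul, ← Finset.sum_sub_distrib]
    refine Finset.sum_congr rfl fun a _ => ?_
    rw [inner_score]
    ring
  have h2 : ∑ a, softmax θ s a * v (s, a) ^ 2 ≤ ∑ a, v (s, a) ^ 2 :=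
    Finset.sum_le_sum fun a _ => mul_le_of_le_one_left (sq_nonneg _) (softmax_le_one θ s a)
  linarith [sq_nonneg (∑ a, softmax θ s a * v (s, a))]

theorem hasDerivAt_log_softmax_line (θ v : Param S A) (s : S) (a : A) (x : ℝ) :
    HasDerivAt (fun y : ℝ => Real.log (softmax (θ + y • v) s a))
      (inner ℝ (score (θ + x • v) s a) v) x := by
  have hl : HasDerivAt (fun y : ℝ => θ + y • v) v x := by
    simpa using ((hasDerivAt_id x).smul_const v).const_add θ
  have h := (hasFDerivAt_log_softmax (θ + x • v) s a).comp_hasDerivAt x hl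
  refine h.congr_deriv ?_
  rw [inner_score]
  simp

theorem hasDerivAt_softmax_line (θ v : Param S A) (s : S) (a : A) (x : ℝ) :
    HasDerivAt (fun y : ℝ => softmax (θ + y • v) s a)
      (softmax (θ + x • v) s a * inner ℝ (score (θ + x • v) s a) v) x := by
  have h := (hasDerivAt_log_softmax_line θ v s a x).exp
  simp only [Real.exp_log (softmax_pos _ s a)] at h
  exact h

/-- In `inner_score` only the subtracted mean of `v` depends on the parameter; the derivative of
that mean is the variance of `v`. -/
theorem hasDerivAt_inner_score_line (θ v : Param S A) (s : S) (a : A) (x : ℝ) :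
    HasDerivAt (fun y : ℝ => inner ℝ (score (θ + y • v) s a) v)
      (-dirVar (θ + x • v) v s) x := by
  simp only [inner_score, dirVar_eq]
  have h := (HasDerivAt.fun_sum fun b (_ : b ∈ Finset.univ) =>
    (hasDerivAt_softmax_line θ v s b x).mul_const (v (s, b))).const_sub (v (s, a))
  simpa only [inner_score] using h

end SoftmaxCalculus

/-! ### Second-order expansion of the mean reward at a fixed time -/

/-- Two monotonicity arguments replace an integral remainder, so `φ''` need not be continuous. -/
theorem abs_sub_sub_le_of_hasDerivAt {φ φ' φ'' : ℝ → ℝ} {B : ℝ}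
    (h1 : ∀ x, HasDerivAt φ (φ' x) x) (h2 : ∀ x, HasDerivAt φ' (φ'' x) x)
    (hB : ∀ x, |φ'' x| ≤ B) : |φ 1 - φ 0 - φ' 0| ≤ B / 2 := by
  have upper : ∀ φ φ' φ'' : ℝ → ℝ, (∀ x, HasDerivAt φ (φ' x) x) →
      (∀ x, HasDerivAt φ' (φ'' x) x) → (∀ x, φ'' x ≤ B) → φ 1 - φ 0 - φ' 0 ≤ B / 2 := by
    intro φ φ' φ'' h1 h2 hB
    have a1 : Antitone fun x => φ' x - B * x := by
      refine antitone_of_hasDerivAt_nonpos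
        (fun x => (h2 x).sub ((hasDerivAt_id x).const_mul B)) fun x => ?_
      show φ'' x - B * 1 ≤ 0
      linarith [hB x]
    have a2 : AntitoneOn (fun x => φ x - (φ' 0 * x + B / 2 * x ^ 2)) (Set.Ici 0) := by
      have hd : ∀ x, HasDerivAt (fun x => φ x - (φ' 0 * x + B / 2 * x ^ 2))
          (φ' x - (φ' 0 + B * x)) x := fun x => by
        refine (h1 x).sub (((hasDerivAt_id x).const_mul _).add
          (((hasDerivAt_id x).pow 2).const_mul _) |>.congr_deriv ?_)
        simp
        ring
      refine antitoneOn_of_hasDerivWithinAt_nonpos (convex_Ici 0)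
        (fun x _ => (hd x).continuousAt.continuousWithinAt)
        (fun x _ => (hd x).hasDerivWithinAt) fun x hx => ?_
      have := a1 (show (0 : ℝ) ≤ x from interior_subset hx)
      simp only at this
      linarith
    have := a2 (show (0 : ℝ) ∈ Set.Ici 0 from Set.mem_Ici.2 le_rfl)
      (show (1 : ℝ) ∈ Set.Ici 0 from Set.mem_Ici.2 zero_le_one)
      zero_le_one
    simp only at this
    linarith
  rw [abs_le]
  have u1 := upper φ φ' φ'' h1 h2 fun x => (abs_le.1 (hB x)).2
  have u2 := upper (fun x => -φ x) (fun x => -φ' x) (fun x => -φ'' x) (fun x => (h1 x).neg)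
    (fun x => (h2 x).neg) fun x => by linarith [(abs_le.1 (hB x)).1]
  constructor <;> linarith

namespace MDP

/-- The sum of the scores along a path. -/
def scoreSum {S A : Type u} [Fintype S] [Fintype A] (θ : Param S A) {H : ℕ} (τ : Fin H → S × A) :
    Param S A :=
  ∑ k, score θ (τ k).1 (τ k).2

theorem sum_Iic_score {S A : Type u} [Fintype S] [Fintype A] (θ : Param S A) {H : ℕ} (t : Fin H)
    (τ : Fin H → S × A) :
    ∑ k ∈ Finset.Iic t, score θ (τ k).1 (τ k).2 =
      scoreSum θ fun i : Fin (t + 1) => τ (Fin.castLE t.2 i) := by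
  have h : Finset.Iic t = Finset.univ.map (Fin.castLEEmb (Nat.succ_le_of_lt t.2)) := by
    ext k
    simp only [Finset.mem_Iic, Finset.mem_map, Finset.mem_univ, true_and, Fin.castLEEmb_apply]
    refine ⟨fun hk => ⟨⟨k, Nat.lt_succ_of_le hk⟩, rfl⟩, ?_⟩
    rintro ⟨i, rfl⟩
    exact Nat.le_of_lt_succ i.2
  rw [h, Finset.sum_map]
  rfl

section Paths

variable {S A : Type u} [Fintype S] [Fintype A]
  [MeasurableSpace S] [MeasurableSingletonClass S]
  [MeasurableSpace A] [MeasurableSingletonClass A]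
  (M : MDP S A)

/-- Pythagoras for martingale differences: given the past, the new term has mean zero, so the cross
term vanishes and each step adds at most `B`. -/
theorem pathExp_norm_sq_sum_le (π : S → PMF A) {E : Type*} [NormedAddCommGroup E]
    [InnerProductSpace ℝ E] {z : S × A → E} {B : ℝ}
    (hz : ∀ s, ∑ a, (π s a).toReal • z (s, a) = 0)
    (hB : ∀ s, ∑ a, (π s a).toReal * ‖z (s, a)‖ ^ 2 ≤ B) (H : ℕ) :
    M.pathExp π H (fun τ => ‖∑ k, z (τ k)‖ ^ 2) ≤ H * B := by
  induction H with
  | zero => simp [pathExp_zero_right]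
  | succ n ih =>
    rw [pathExp_succ]
    refine le_trans (M.pathExp_mono π (G := fun τ => ‖∑ k, z (τ k)‖ ^ 2 + B) fun τ => ?_) ?_
    · set Z := ∑ k, z (τ k) with hZ
      have inner_le : ∀ s, ∑ a, (π s a).toReal • ‖∑ k,
          z ((Fin.snoc (α := fun _ => S × A) τ (s, a) : Fin (n + 1) → S × A) k)‖ ^ 2 ≤
            ‖Z‖ ^ 2 + B := fun s => by
        have h0 : ∑ a, (π s a).toReal * inner ℝ Z (z (s, a)) = 0 := by
          simp only [← real_inner_smul_right, ← inner_sum, hz s, inner_zero_right]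
        have h1 : ∀ a, (π s a).toReal • ‖∑ k,
            z ((Fin.snoc (α := fun _ => S × A) τ (s, a) : Fin (n + 1) → S × A) k)‖ ^ 2 =
            (π s a).toReal * ‖Z‖ ^ 2 + 2 * ((π s a).toReal * inner ℝ Z (z (s, a))) +
              (π s a).toReal * ‖z (s, a)‖ ^ 2 := fun a => by
          simp only [Fin.sum_univ_castSucc, Fin.snoc_castSucc, Fin.snoc_last, ← hZ]
          rw [norm_add_sq_real, smul_eq_mul]
          ring
        rw [Finset.sum_congr rfl fun a _ => h1 a, Finset.sum_add_distrib, Finset.sum_add_distrib,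
          ← Finset.mul_sum, ← Finset.sum_mul, sum_toReal_pmf, h0]
        linarith [hB s]
      refine (Finset.sum_le_sum fun s _ => smul_le_smul_of_nonneg_left (inner_le s)
        ENNReal.toReal_nonneg).trans_eq ?_
      rw [← Finset.sum_smul, sum_toReal_pmf, one_smul]
    · rw [pathExp_add, pathExp_const]
      push_cast
      linarith

variable [Nonempty A]

theorem pathExp_norm_sq_scoreSum_le (θ : Param S A) (H : ℕ) :
    M.pathExp (softmaxPolicy θ) H (fun τ => ‖scoreSum θ τ‖ ^ 2) ≤
      H * (1 - 1 / (Fintype.card A : ℝ)) := by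
  refine M.pathExp_norm_sq_sum_le (softmaxPolicy θ) (z := fun x => score θ x.1 x.2)
    (fun s => ?_) (fun s => ?_) H
  · simp only [toReal_softmaxPolicy, sum_softmax_smul_score]
  · simp only [toReal_softmaxPolicy, sum_softmax_mul_norm_score_sq_le]

/-- The likelihood-ratio identity, with an integrand that may itself depend on the parameter;
applying it twice gives second derivatives. -/
theorem hasDerivAt_pathExp_line (θ v : Param S A) {H : ℕ} {F F' : ℝ → (Fin H → S × A) → ℝ}
    (x : ℝ) (hF : ∀ τ, HasDerivAt (fun y => F y τ) (F' x τ) x) :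
    HasDerivAt (fun y => M.pathExp (softmaxPolicy (θ + y • v)) H (F y))
      (M.pathExp (softmaxPolicy (θ + x • v)) H fun τ =>
        F' x τ + F x τ * inner ℝ (scoreSum (θ + x • v) τ) v) x := by
  classical
  obtain ⟨c, hc⟩ := M.exists_truncLaw_eq_prod H
  simp only [pathExp, hc, toReal_softmaxPolicy, smul_eq_mul]
  refine HasDerivAt.fun_sum fun τ _ => ?_
  have hp := HasDerivAt.fun_finsetProd (u := Finset.univ) fun (k : Fin H) _ =>
    hasDerivAt_softmax_line θ v (τ k).1 (τ k).2 x
  refine ((hp.const_mul (c τ)).mul (hF τ)).congr_deriv ?_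
  have hs : (∑ i : Fin H, (∏ j ∈ Finset.univ.erase i, softmax (θ + x • v) (τ j).1 (τ j).2) •
      (softmax (θ + x • v) (τ i).1 (τ i).2 * inner ℝ (score (θ + x • v) (τ i).1 (τ i).2) v)) =
      (∏ k, softmax (θ + x • v) (τ k).1 (τ k).2) * inner ℝ (scoreSum (θ + x • v) τ) v := by
    rw [scoreSum, sum_inner, Finset.mul_sum]
    refine Finset.sum_congr rfl fun i _ => ?_
    rw [← Finset.prod_erase_mul _ _ (Finset.mem_univ i), smul_eq_mul, mul_assoc]
  rw [hs]
  ring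

/-- The gradient of the mean of `f (s_t, a_t)` under `π_θ`. -/
def stepGrad (θ : Param S A) (t : ℕ) (f : S × A → ℝ) : Param S A :=
  M.pathExp (softmaxPolicy θ) (t + 1) fun τ => f (τ (Fin.last t)) • scoreSum θ τ

theorem hasDerivAt_pathExp_const_line (θ v : Param S A) {H : ℕ} (F : (Fin H → S × A) → ℝ)
    (x : ℝ) :
    HasDerivAt (fun y => M.pathExp (softmaxPolicy (θ + y • v)) H F)
      (M.pathExp (softmaxPolicy (θ + x • v)) H fun τ =>
        F τ * inner ℝ (scoreSum (θ + x • v) τ) v) x := by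
  have h := M.hasDerivAt_pathExp_line θ v (F := fun _ => F) (F' := fun _ _ => 0) x
    fun τ => hasDerivAt_const x _
  simpa only [zero_add] using h

theorem abs_stepExp_sub_sub_le (θ v : Param S A) (t : ℕ) {f : S × A → ℝ} {B : ℝ}
    (hf : ∀ x, |f x| ≤ B) :
    |M.stepExp (softmaxPolicy (θ + v)) t f - M.stepExp (softmaxPolicy θ) t f -
        inner ℝ (M.stepGrad θ t f) v| ≤
      B * (t + 1) * (1 - 1 / (Fintype.card A : ℝ)) * ‖v‖ ^ 2 := by
  set G := 1 - 1 / (Fintype.card A : ℝ) with hG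
  have hB0 : 0 ≤ B := by
    obtain ⟨s, -⟩ := M.ρ.support_nonempty
    exact (abs_nonneg _).trans (hf (s, Classical.arbitrary A))
  have h1 := M.hasDerivAt_pathExp_const_line θ v (H := t + 1) (fun τ => f (τ (Fin.last t)))
  have h2 := fun x => M.hasDerivAt_pathExp_line θ v (H := t + 1)
    (F := fun y τ => f (τ (Fin.last t)) * inner ℝ (scoreSum (θ + y • v) τ) v)
    (F' := fun y τ => f (τ (Fin.last t)) * ∑ k, -dirVar (θ + y • v) v (τ k).1) x fun τ => by
      simp only [scoreSum, sum_inner]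
      exact (HasDerivAt.fun_sum fun k _ => hasDerivAt_inner_score_line θ v _ _ x).const_mul _
  -- The derivative of the scores and the square of `scoreSum` contribute equally; the resulting
  -- factor 2 cancels the 1/2 of the Taylor remainder.
  have h := abs_sub_sub_le_of_hasDerivAt (B := 2 * (B * (t + 1) * G * ‖v‖ ^ 2)) h1 h2 fun x => by
    rw [← Real.norm_eq_abs]
    refine (M.norm_pathExp_le _ _).trans ?_
    refine (M.pathExp_mono _ (G := fun τ => B * ((t + 1) * (G * ‖v‖ ^ 2)) +
      B * ‖v‖ ^ 2 * ‖scoreSum (θ + x • v) τ‖ ^ 2) fun τ => ?_).trans ?_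
    · refine (norm_add_le _ _).trans (add_le_add ?_ ?_)
      · rw [norm_mul]
        refine mul_le_mul (hf _) ?_ (norm_nonneg _) hB0
        refine (norm_sum_le _ _).trans ((Finset.sum_le_card_nsmul _ _ (G * ‖v‖ ^ 2)
          fun k _ => ?_).trans_eq ?_)
        · rw [norm_neg, Real.norm_of_nonneg (dirVar_nonneg _ _ _)]
          exact dirVar_le _ _ _
        · simp
      · rw [mul_assoc, norm_mul, mul_assoc]
        refine mul_le_mul (hf _) ?_ (norm_nonneg _) hB0
        rw [← sq, norm_pow, Real.norm_eq_abs, ← mul_pow, mul_comm ‖v‖]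
        exact pow_le_pow_left₀ (abs_nonneg _) (abs_real_inner_le_norm _ _) 2
    · rw [pathExp_add, pathExp_const, pathExp_mul]
      have := mul_le_mul_of_nonneg_left (M.pathExp_norm_sq_scoreSum_le (θ + x • v) (t + 1))
        (mul_nonneg hB0 (sq_nonneg ‖v‖))
      rw [← hG] at this
      push_cast at this
      linarith
  simp only [one_smul, zero_smul, add_zero] at h
  rw [mul_div_cancel_left₀ _ two_ne_zero] at h
  rw [stepGrad, inner_pathExp]
  simp only [real_inner_smul_left]
  exact h

/-- The inequality `x ≤ (1 + x²)/2` reduces the first moment of `‖scoreSum‖` to the second. Linear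
growth in `t` is enough for the series of gradients to converge. -/
theorem norm_stepGrad_le (θ : Param S A) (t : ℕ) {f : S × A → ℝ} {B : ℝ}
    (hf : ∀ x, |f x| ≤ B) : ‖M.stepGrad θ t f‖ ≤ B * (t + 1) := by
  have hB0 : 0 ≤ B := by
    obtain ⟨s, -⟩ := M.ρ.support_nonempty
    exact (abs_nonneg _).trans (hf (s, Classical.arbitrary A))
  refine (M.norm_pathExp_le _ _).trans ((M.pathExp_mono _ (G := fun τ =>
    B / 2 * (1 + ‖scoreSum θ τ‖ ^ 2)) fun τ => ?_).trans ?_)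
  · rw [norm_smul]
    refine (mul_le_mul_of_nonneg_right (hf _) (norm_nonneg _)).trans ?_
    rw [div_mul_eq_mul_div, mul_div_assoc]
    refine mul_le_mul_of_nonneg_left ?_ hB0
    linarith [sq_nonneg (‖scoreSum θ τ‖ - 1)]
  · rw [pathExp_mul, pathExp_add, pathExp_const]
    have h1 := M.pathExp_norm_sq_scoreSum_le θ (t + 1)
    have h2 : 0 < 1 / (Fintype.card A : ℝ) := by
      have : 0 < Fintype.card A := Fintype.card_pos
      positivity
    have h3 : ((t + 1 : ℕ) : ℝ) * (1 - 1 / (Fintype.card A : ℝ)) ≤ t + 1 := by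
      push_cast
      nlinarith
    have h4 : (0 : ℝ) ≤ t := Nat.cast_nonneg t
    nlinarith

end Paths
end MDP

/-! ### Smoothness of the log barrier objective -/

/-- A quadratic remainder is `o(‖v‖)`, so the smoothness estimate itself identifies the gradient and
no series has to be differentiated termwise. -/
theorem hasGradientAt_of_abs_sub_sub_le {E : Type*} [NormedAddCommGroup E]
    [InnerProductSpace ℝ E] [CompleteSpace E] {f : E → ℝ} {g θ : E} {K : ℝ}
    (h : ∀ v, |f (θ + v) - f θ - inner ℝ g v| ≤ K * ‖v‖ ^ 2) : HasGradientAt f g θ := by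
  rw [hasGradientAt_iff_hasFDerivAt, hasFDerivAt_iff_isLittleO_nhds_zero]
  refine (Asymptotics.IsBigO.of_bound K (Filter.Eventually.of_forall fun v => ?_)).trans_isLittleO
    ((Asymptotics.isLittleO_norm_pow_id one_lt_two))
  rw [InnerProductSpace.toDual_apply_apply, Real.norm_eq_abs, norm_pow, norm_norm]
  exact h v

theorem hasSum_succ_mul_geometric {γ : ℝ} (h0 : 0 ≤ γ) (h1 : γ < 1) :
    HasSum (fun t : ℕ => ((t : ℝ) + 1) * γ ^ t) (1 / (1 - γ) ^ 2) := by
  have hn : ‖γ‖ < 1 := by rwa [Real.norm_of_nonneg h0]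
  have h := (hasSum_coe_mul_geometric_of_norm_lt_one hn).add (hasSum_geometric_of_lt_one h0 h1)
  have hne : 1 - γ ≠ 0 := by linarith
  have e : γ / (1 - γ) ^ 2 + (1 - γ)⁻¹ = 1 / (1 - γ) ^ 2 := by
    field_simp
    ring
  rw [e] at h
  simpa only [add_mul, one_mul] using h

theorem hasSum_nat_add_succ_mul_geometric {γ : ℝ} (h0 : 0 ≤ γ) (h1 : γ < 1) (H : ℕ) :
    HasSum (fun t : ℕ => (((t + H : ℕ) : ℝ) + 1) * γ ^ (t + H))
      (γ ^ H * (1 / (1 - γ) ^ 2 + H * (1 - γ)⁻¹)) := by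
  have h := ((hasSum_succ_mul_geometric h0 h1).add
    ((hasSum_geometric_of_lt_one h0 h1).mul_left (H : ℝ))).mul_left (γ ^ H)
  refine h.congr_fun fun t => ?_
  push_cast
  ring

section Barrier

variable {S A : Type u} [Fintype S] [Fintype A] [Nonempty A]

/-- The gradient of the log barrier. -/
def barrierGrad (lam : ℝ) (θ : Param S A) : Param S A :=
  (lam / (Fintype.card A * Fintype.card S)) • ∑ s : S, ∑ a : A, score θ s a

theorem barrierGrad_apply (lam : ℝ) (θ : Param S A) (s : S) (a : A) :
    barrierGrad lam θ (s, a) =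
      lam / (Fintype.card A * Fintype.card S) * (1 - Fintype.card A * softmax θ s a) := by
  classical
  simp [barrierGrad, score_apply, Finset.sum_sub_distrib]

/-- The second derivative along a line is `-(λ/|S|) ∑_s dirVar`, and the statewise bounds
`dirVar_le_sum_sq` add up to `‖v‖²`. -/
theorem abs_logBarrier_sub_sub_le {lam : ℝ} (hlam : 0 ≤ lam) (θ v : Param S A) :
    |logBarrier lam (θ + v) - logBarrier lam θ - inner ℝ (barrierGrad lam θ) v| ≤
      lam / Fintype.card S * ‖v‖ ^ 2 / 2 := by
  have h1 : ∀ x, HasDerivAt (fun y : ℝ => logBarrier lam (θ + y • v))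
      (lam / (Fintype.card A * Fintype.card S) *
        ∑ s : S, ∑ a : A, inner ℝ (score (θ + x • v) s a) v) x := fun x =>
    (HasDerivAt.fun_sum fun s _ => HasDerivAt.fun_sum fun a _ =>
      hasDerivAt_log_softmax_line θ v s a x).const_mul _
  have h2 : ∀ x, HasDerivAt (fun x : ℝ => lam / (Fintype.card A * Fintype.card S) *
        ∑ s : S, ∑ a : A, inner ℝ (score (θ + x • v) s a) v)
      (lam / (Fintype.card A * Fintype.card S) *
        ∑ s : S, ∑ _a : A, -dirVar (θ + x • v) v s) x := fun x =>
    (HasDerivAt.fun_sum fun s _ => HasDerivAt.fun_sum fun a _ =>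
      hasDerivAt_inner_score_line θ v s a x).const_mul _
  have h := abs_sub_sub_le_of_hasDerivAt (B := lam / Fintype.card S * ‖v‖ ^ 2) h1 h2 fun x => by
    have hA : (Fintype.card A : ℝ) ≠ 0 := by exact_mod_cast Fintype.card_ne_zero
    simp only [Finset.sum_const, Finset.card_univ, nsmul_eq_mul, ← Finset.mul_sum,
      Finset.sum_neg_distrib, mul_neg, abs_neg]
    rw [← mul_assoc, show lam / (Fintype.card A * Fintype.card S) * (Fintype.card A : ℝ) =
      lam / Fintype.card S by field_simp, abs_mul, abs_of_nonneg (by positivity),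
      abs_of_nonneg (Finset.sum_nonneg fun s _ => dirVar_nonneg _ _ _)]
    refine mul_le_mul_of_nonneg_left ?_ (by positivity)
    rw [EuclideanSpace.real_norm_sq_eq, Fintype.sum_prod_type]
    exact Finset.sum_le_sum fun s _ => dirVar_le_sum_sq _ _ _
  simp only [one_smul, zero_smul, add_zero] at h
  rw [barrierGrad, real_inner_smul_left]
  simp only [sum_inner]
  exact h

end Barrier

namespace MDP

theorem nonneg_of_abs_reward_le {S A : Type u} [Nonempty A] (M : MDP S A) {B : ℝ}
    (hB : ∀ s a, |M.R s a| ≤ B) : 0 ≤ B := by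
  obtain ⟨s, -⟩ := M.ρ.support_nonempty
  exact (abs_nonneg _).trans (hB s (Classical.arbitrary A))

section Return

variable {S A : Type u} [Fintype S] [Fintype A]
  [MeasurableSpace S] [MeasurableSingletonClass S]
  [MeasurableSpace A] [MeasurableSingletonClass A]
  [Nonempty A] (M : MDP S A)

/-- The gradient of the expected return `J(θ)`. -/
def retGrad (θ : Param S A) : Param S A :=
  ∑' t, M.γ ^ t • M.stepGrad θ t fun x => M.R x.1 x.2

/-- The gradient of the expected return over the first `H` steps. -/
def truncRetGrad (H : ℕ) (θ : Param S A) : Param S A :=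
  ∑ t ∈ Finset.range H, M.γ ^ t • M.stepGrad θ t fun x => M.R x.1 x.2

theorem norm_pow_smul_stepGrad_le {B : ℝ} (hB : ∀ s a, |M.R s a| ≤ B) (θ : Param S A) (t : ℕ) :
    ‖M.γ ^ t • M.stepGrad θ t fun x => M.R x.1 x.2‖ ≤ B * ((t + 1) * M.γ ^ t) := by
  rw [norm_smul, Real.norm_of_nonneg (pow_nonneg M.γ_nonneg t), mul_comm]
  refine (mul_le_mul_of_nonneg_right (M.norm_stepGrad_le θ t fun x => hB x.1 x.2)
    (pow_nonneg M.γ_nonneg t)).trans_eq ?_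
  ring

theorem summable_stepGrad {B : ℝ} (hB : ∀ s a, |M.R s a| ≤ B) (θ : Param S A) :
    Summable fun t => M.γ ^ t • M.stepGrad θ t fun x => M.R x.1 x.2 :=
  Summable.of_norm_bounded
    ((hasSum_succ_mul_geometric M.γ_nonneg M.γ_lt_one).summable.mul_left B)
    (M.norm_pow_smul_stepGrad_le hB θ)

theorem norm_retGrad_sub_truncRetGrad_le {B : ℝ} (hB : ∀ s a, |M.R s a| ≤ B) (H : ℕ)
    (θ : Param S A) :
    ‖M.retGrad θ - M.truncRetGrad H θ‖ ≤
      B * (M.γ ^ H * (1 / (1 - M.γ) ^ 2 + H * (1 - M.γ)⁻¹)) := by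
  rw [retGrad, truncRetGrad, ← (M.summable_stepGrad hB θ).sum_add_tsum_nat_add H,
    add_sub_cancel_left]
  exact tsum_of_norm_bounded
    ((hasSum_nat_add_succ_mul_geometric M.γ_nonneg M.γ_lt_one H).mul_left B)
    fun t => M.norm_pow_smul_stepGrad_le hB θ (t + H)

/-- The remainder at time `t` grows only linearly, and `∑ (t + 1) γ^t = (1 - γ)⁻²`: this is the
source of the improved smoothness constant. -/
theorem abs_J_sub_sub_le {B : ℝ} (hB : ∀ s a, |M.R s a| ≤ B) (θ v : Param S A) :
    |M.J (softmaxPolicy (θ + v)) - M.J (softmaxPolicy θ) - inner ℝ (M.retGrad θ) v| ≤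
      B / (1 - M.γ) ^ 2 * (1 - 1 / (Fintype.card A : ℝ)) * ‖v‖ ^ 2 := by
  have hs := ((M.summable_stepGrad hB θ).hasSum.mapL (innerSL ℝ v))
  simp only [innerSL_apply_apply] at hs
  have hs1 := ((M.summable_stepExp (softmaxPolicy (θ + v)) fun x => M.R x.1 x.2).hasSum.sub
    (M.summable_stepExp (softmaxPolicy θ) fun x => M.R x.1 x.2).hasSum).sub hs
  rw [← J_eq_tsum, ← J_eq_tsum, real_inner_comm] at hs1
  rw [← Real.norm_eq_abs, retGrad, ← hs1.tsum_eq]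
  refine tsum_of_norm_bounded (g := fun t : ℕ => B * (1 - 1 / (Fintype.card A : ℝ)) * ‖v‖ ^ 2 *
    (((t : ℝ) + 1) * M.γ ^ t)) ?_ fun t => ?_
  · rw [show B / (1 - M.γ) ^ 2 * (1 - 1 / (Fintype.card A : ℝ)) * ‖v‖ ^ 2 =
      B * (1 - 1 / (Fintype.card A : ℝ)) * ‖v‖ ^ 2 * (1 / (1 - M.γ) ^ 2) by ring]
    exact (hasSum_succ_mul_geometric M.γ_nonneg M.γ_lt_one).mul_left _
  · rw [real_inner_smul_right, ← mul_sub, ← mul_sub, norm_mul,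
      Real.norm_of_nonneg (pow_nonneg M.γ_nonneg t), real_inner_comm]
    refine (mul_le_mul_of_nonneg_left
      (M.abs_stepExp_sub_sub_le θ v t fun x => hB x.1 x.2)
      (pow_nonneg M.γ_nonneg t)).trans_eq ?_
    ring

/-- The gradient of the log barrier objective. -/
def objGrad (lam : ℝ) (θ : Param S A) : Param S A := M.retGrad θ + barrierGrad lam θ

theorem abs_barrierObj_sub_sub_le {B lam : ℝ} (hB : ∀ s a, |M.R s a| ≤ B) (hlam : 0 ≤ lam)
    (θ v : Param S A) :
    |M.barrierObj lam (θ + v) - M.barrierObj lam θ - inner ℝ (M.objGrad lam θ) v| ≤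
      smoothConst B M.γ lam (Fintype.card S) (Fintype.card A) / 2 * ‖v‖ ^ 2 := by
  have h1 := M.abs_J_sub_sub_le hB θ v
  have h2 := abs_logBarrier_sub_sub_le hlam θ v
  -- The return alone has constant `2 (1 - 1/|A|)`; `smoothConst` is allowed the larger `2 - 1/|A|`.
  have h3 : B / (1 - M.γ) ^ 2 * (1 - 1 / (Fintype.card A : ℝ)) * ‖v‖ ^ 2 ≤
      B / (1 - M.γ) ^ 2 * (2 - 1 / (Fintype.card A : ℝ)) / 2 * ‖v‖ ^ 2 := by
    refine mul_le_mul_of_nonneg_right ?_ (sq_nonneg _)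
    rw [mul_div_assoc]
    refine mul_le_mul_of_nonneg_left ?_
      (div_nonneg (M.nonneg_of_abs_reward_le hB) (sq_nonneg _))
    have : 0 ≤ 1 / (Fintype.card A : ℝ) := by positivity
    linarith
  have e : M.barrierObj lam (θ + v) - M.barrierObj lam θ - inner ℝ (M.objGrad lam θ) v =
      (M.J (softmaxPolicy (θ + v)) - M.J (softmaxPolicy θ) - inner ℝ (M.retGrad θ) v) +
      (logBarrier lam (θ + v) - logBarrier lam θ - inner ℝ (barrierGrad lam θ) v) := by
    simp only [barrierObj, objGrad, inner_add_left]
    ring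
  rw [e, smoothConst]
  refine (abs_add_le _ _).trans ((add_le_add (h1.trans h3) h2).trans_eq ?_)
  ring

theorem gradient_barrierObj {lam : ℝ} (hlam : 0 ≤ lam) (θ : Param S A) :
    gradient (M.barrierObj lam) θ = M.objGrad lam θ := by
  obtain ⟨B, hB⟩ := exists_abs_le fun x : S × A => M.R x.1 x.2
  exact (hasGradientAt_of_abs_sub_sub_le
    (M.abs_barrierObj_sub_sub_le (fun s a => hB (s, a)) hlam θ)).gradient

theorem hasGradientAt_J (θ : Param S A) :
    HasGradientAt (fun θ' => M.J (softmaxPolicy θ')) (M.retGrad θ) θ := by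
  obtain ⟨B, hB⟩ := exists_abs_le fun x : S × A => M.R x.1 x.2
  exact hasGradientAt_of_abs_sub_sub_le (M.abs_J_sub_sub_le (fun s a => hB (s, a)) θ)

end Return


/-! ### Mean and second moment of the gradient estimators -/

theorem trajGrad_reinforce {S A : Type u} [Fintype S] [Fintype A] (M : MDP S A) (θ : Param S A)
    {H : ℕ} (τ : Fin H → S × A) :
    M.trajGrad .reinforce θ τ =
      ∑ t : Fin H, M.γ ^ (t : ℕ) • M.R (τ t).1 (τ t).2 • scoreSum θ τ := by
  simp only [trajGrad, Finset.sum_smul, mul_smul]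
  rfl

theorem trajGrad_gpomdp {S A : Type u} [Fintype S] [Fintype A] (M : MDP S A) (θ : Param S A)
    {H : ℕ} (τ : Fin H → S × A) :
    M.trajGrad .gpomdp θ τ = ∑ t : Fin H, M.γ ^ (t : ℕ) • M.R (τ t).1 (τ t).2 •
      scoreSum θ fun i : Fin (t + 1) => τ (Fin.castLE t.2 i) := by
  simp only [trajGrad, mul_smul, sum_Iic_score]

theorem sum_fin_pow_le {S A : Type u} (M : MDP S A) (H : ℕ) :
    ∑ t : Fin H, M.γ ^ (t : ℕ) ≤ (1 - M.γ)⁻¹ := by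
  rw [Fin.sum_univ_eq_sum_range fun t => M.γ ^ t,
    ← tsum_geometric_of_lt_one M.γ_nonneg M.γ_lt_one]
  exact (summable_geometric_of_lt_one M.γ_nonneg M.γ_lt_one).sum_le_tsum _
    fun t _ => pow_nonneg M.γ_nonneg t

section Estimators

variable {S A : Type u} [Fintype S] [Fintype A]
  [MeasurableSpace S] [MeasurableSingletonClass S]
  [MeasurableSpace A] [MeasurableSingletonClass A]
  [Nonempty A] (M : MDP S A)

/-- Scores after time `t` do not contribute. Both sides are derivatives of the same function, the
mean of `f (s_t, a_t)` computed on paths of two lengths, so uniqueness of derivatives replaces a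
conditioning argument. -/
theorem inner_pathExp_smul_scoreSum (θ v : Param S A) {H : ℕ} (t : Fin H) (f : S × A → ℝ) :
    inner ℝ (M.pathExp (softmaxPolicy θ) H fun τ => f (τ t) • scoreSum θ τ) v =
      inner ℝ (M.stepGrad θ t f) v := by
  have h1 := M.hasDerivAt_pathExp_const_line θ v (H := H) (fun τ => f (τ t)) 0
  have h2 := M.hasDerivAt_pathExp_const_line θ v (H := t + 1) (fun τ => f (τ (Fin.last t))) 0
  simp only [pathExp_apply] at h1
  have h := h1.unique h2
  simp only [zero_smul, add_zero] at h
  rw [stepGrad, inner_pathExp, inner_pathExp]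
  simp only [real_inner_smul_left]
  exact h

theorem pathExp_trajGrad (e : Estimator) (θ : Param S A) (H : ℕ) :
    M.pathExp (softmaxPolicy θ) H (fun τ => M.trajGrad e θ τ) = M.truncRetGrad H θ := by
  rw [truncRetGrad, ← Fin.sum_univ_eq_sum_range
    fun t => M.γ ^ t • M.stepGrad θ t fun x => M.R x.1 x.2]
  cases e with
  | reinforce =>
    refine ext_inner_right ℝ fun v => ?_
    simp only [trajGrad_reinforce, pathExp_sum, pathExp_smul, sum_inner, real_inner_smul_left]
    exact Finset.sum_congr rfl fun t _ => congrArg _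
      (M.inner_pathExp_smul_scoreSum θ v t fun x => M.R x.1 x.2)
  | gpomdp =>
    simp only [trajGrad_gpomdp, pathExp_sum, pathExp_smul]
    exact Finset.sum_congr rfl fun t _ => congrArg _
      (M.pathExp_castLE (softmaxPolicy θ) (n := t + 1) (H := H) t.2
        fun τ => M.R (τ (Fin.last t)).1 (τ (Fin.last t)).2 • scoreSum θ τ)

theorem pathExp_norm_sq_reinforce_le {B : ℝ} (hB : ∀ s a, |M.R s a| ≤ B) (θ : Param S A) (H : ℕ) :
    M.pathExp (softmaxPolicy θ) H (fun τ => ‖M.trajGrad .reinforce θ τ‖ ^ 2) ≤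
      (1 - 1 / (Fintype.card A : ℝ)) * (H * B ^ 2 / (1 - M.γ) ^ 2) := by
  have hB0 := M.nonneg_of_abs_reward_le hB
  refine (M.pathExp_mono _ (G := fun τ => (B * (1 - M.γ)⁻¹) ^ 2 * ‖scoreSum θ τ‖ ^ 2)
    fun τ => ?_).trans ?_
  · rw [← mul_pow]
    refine pow_le_pow_left₀ (norm_nonneg _) ?_ 2
    rw [trajGrad_reinforce]
    simp only [← mul_smul, ← Finset.sum_smul]
    rw [norm_smul]
    refine mul_le_mul_of_nonneg_right ?_ (norm_nonneg _)
    refine (norm_sum_le _ _).trans (le_trans ?_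
      (mul_le_mul_of_nonneg_left (M.sum_fin_pow_le H) hB0))
    rw [Finset.mul_sum]
    refine Finset.sum_le_sum fun t _ => ?_
    rw [norm_mul, mul_comm, Real.norm_of_nonneg (pow_nonneg M.γ_nonneg _)]
    exact mul_le_mul_of_nonneg_right (hB _ _) (pow_nonneg M.γ_nonneg _)
  · rw [pathExp_mul]
    refine (mul_le_mul_of_nonneg_left (M.pathExp_norm_sq_scoreSum_le θ H)
      (sq_nonneg _)).trans_eq ?_
    field_simp

theorem pathExp_norm_sq_gpomdp_le {B : ℝ} (hB : ∀ s a, |M.R s a| ≤ B) (θ : Param S A) (H : ℕ) :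
    M.pathExp (softmaxPolicy θ) H (fun τ => ‖M.trajGrad .gpomdp θ τ‖ ^ 2) ≤
      (1 - 1 / (Fintype.card A : ℝ)) * (B ^ 2 / (1 - M.γ) ^ 3) := by
  have hB0 := M.nonneg_of_abs_reward_le hB
  have hγ := M.γ_nonneg
  have hγ1 : 0 < 1 - M.γ := sub_pos.2 M.γ_lt_one
  set G := 1 - 1 / (Fintype.card A : ℝ) with hG
  have hG0 : 0 ≤ G := by
    have : (1 : ℝ) ≤ Fintype.card A := by exact_mod_cast Fintype.card_pos
    rw [hG, sub_nonneg, div_le_one (by linarith)]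
    exact this
  refine (M.pathExp_mono _ (G := fun τ => (1 - M.γ)⁻¹ * ∑ t : Fin H, (M.γ ^ (t : ℕ) * B ^ 2) *
    ‖scoreSum θ fun i : Fin (t + 1) => τ (Fin.castLE t.2 i)‖ ^ 2) fun τ => ?_).trans ?_
  · refine le_trans (pow_le_pow_left₀ (norm_nonneg _) (b := ∑ t : Fin H, M.γ ^ (t : ℕ) *
      (B * ‖scoreSum θ fun i : Fin (t + 1) => τ (Fin.castLE t.2 i)‖)) ?_ 2) ?_
    · rw [trajGrad_gpomdp]
      refine (norm_sum_le _ _).trans (Finset.sum_le_sum fun t _ => ?_)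
      rw [norm_smul, norm_smul, Real.norm_of_nonneg (pow_nonneg hγ _)]
      exact mul_le_mul_of_nonneg_left (mul_le_mul_of_nonneg_right (hB _ _) (norm_nonneg _))
        (pow_nonneg hγ _)
    -- Cauchy-Schwarz with weights `γ^t`: the total weight gives one factor `(1 - γ)⁻¹` and the sum
    -- of `(t + 1) γ^t` gives two more, with no dependence on `H`.
    · refine (Finset.sum_sq_le_sum_mul_sum_of_sq_le_mul _ (f := fun t : Fin H => M.γ ^ (t : ℕ))
        (g := fun t : Fin H => (M.γ ^ (t : ℕ) * B ^ 2) *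
          ‖scoreSum θ fun i : Fin (t + 1) => τ (Fin.castLE t.2 i)‖ ^ 2)
        (fun t _ => pow_nonneg hγ _) (fun t _ => by positivity) fun t _ => by
          apply le_of_eq; ring).trans ?_
      exact mul_le_mul_of_nonneg_right (M.sum_fin_pow_le H)
        (Finset.sum_nonneg fun t _ => by positivity)
  · rw [pathExp_mul, pathExp_sum]
    have hle : ∀ t : Fin H, M.pathExp (softmaxPolicy θ) H (fun τ => (M.γ ^ (t : ℕ) * B ^ 2) *
        ‖scoreSum θ fun i : Fin (t + 1) => τ (Fin.castLE t.2 i)‖ ^ 2) ≤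
        B ^ 2 * G * (((t : ℕ) + 1) * M.γ ^ (t : ℕ)) := fun t => by
      rw [pathExp_mul, M.pathExp_castLE (softmaxPolicy θ) (n := t + 1) (H := H) t.2
        fun τ => ‖scoreSum θ τ‖ ^ 2]
      refine (mul_le_mul_of_nonneg_left (M.pathExp_norm_sq_scoreSum_le θ (t + 1))
        (by positivity)).trans_eq ?_
      push_cast
      ring
    have hsum := hasSum_succ_mul_geometric hγ M.γ_lt_one
    have hfin : ∑ t : Fin H, (((t : ℕ) : ℝ) + 1) * M.γ ^ (t : ℕ) ≤ 1 / (1 - M.γ) ^ 2 := by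
      rw [Fin.sum_univ_eq_sum_range fun t => ((t : ℝ) + 1) * M.γ ^ t, ← hsum.tsum_eq]
      exact hsum.summable.sum_le_tsum _ fun t _ => by positivity
    have h3 := (Finset.sum_le_sum fun t (_ : t ∈ Finset.univ) => hle t)
    rw [← Finset.mul_sum] at h3
    refine (mul_le_mul_of_nonneg_left (h3.trans (mul_le_mul_of_nonneg_left hfin (by positivity)))
      (by positivity)).trans_eq ?_
    field_simp

end Estimators

end MDP

/-! ### Independent batches and one step of stochastic ascent -/

section Batch

variable {α : Type*} [Fintype α] (p : PMF α)

theorem iidLaw_toReal (m : ℕ) (b : Fin m → α) :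
    (iidLaw p m b).toReal = ∏ i, (p (b i)).toReal := by
  rw [iidLaw, PMF.ofFintype_apply, ENNReal.toReal_prod]

theorem sum_iidLaw_succ (m : ℕ) {E : Type*} [AddCommGroup E] [Module ℝ E]
    (F : (Fin (m + 1) → α) → E) :
    ∑ b, (iidLaw p (m + 1) b).toReal • F b =
      ∑ b, (iidLaw p m b).toReal • ∑ a, (p a).toReal •
        F (Fin.cons (α := fun _ => α) a b) := by
  classical
  rw [← (Fin.consEquiv fun _ => α).sum_comp, Fintype.sum_prod_type_right]
  refine Finset.sum_congr rfl fun b _ => ?_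
  rw [Finset.smul_sum]
  refine Finset.sum_congr rfl fun a _ => ?_
  rw [show Fin.consEquiv (fun _ => α) (a, b) = Fin.cons (α := fun _ => α) a b from rfl,
    iidLaw_toReal, iidLaw_toReal, Fin.prod_univ_succ, smul_smul, mul_comm]
  simp only [Fin.cons_zero, Fin.cons_succ]

variable {E : Type*} [NormedAddCommGroup E] [InnerProductSpace ℝ E] {z : α → E}

theorem sum_iidLaw_smul_sum_eq_zero (hz : ∑ a, (p a).toReal • z a = 0) (m : ℕ) :
    ∑ b, (iidLaw p m b).toReal • ∑ i, z (b i) = 0 := by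
  classical
  induction m with
  | zero => simp
  | succ m ih =>
    rw [sum_iidLaw_succ]
    simpa only [Fin.sum_univ_succ, Fin.cons_zero, Fin.cons_succ, smul_add,
      Finset.sum_add_distrib, hz, ← Finset.sum_smul, MDP.sum_toReal_pmf, one_smul, smul_zero,
      zero_add] using ih

theorem sum_iidLaw_mul_norm_sq_sum (hz : ∑ a, (p a).toReal • z a = 0) (m : ℕ) :
    ∑ b, (iidLaw p m b).toReal * ‖∑ i, z (b i)‖ ^ 2 = m * ∑ a, (p a).toReal * ‖z a‖ ^ 2 := by
  classical
  induction m with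
  | zero => simp
  | succ m ih =>
    have h := sum_iidLaw_succ p m fun b => ‖∑ i, z (b i)‖ ^ 2
    simp only [smul_eq_mul] at h
    rw [h]
    have h1 : ∀ b : Fin m → α, ∑ a, (p a).toReal *
        ‖∑ i, z ((Fin.cons (α := fun _ => α) a b : Fin (m + 1) → α) i)‖ ^ 2 =
        ∑ a, (p a).toReal * ‖z a‖ ^ 2 + ‖∑ i, z (b i)‖ ^ 2 := fun b => by
      have h0 : ∑ a, (p a).toReal * inner ℝ (z a) (∑ i, z (b i)) = 0 := by
        simp only [← real_inner_smul_left, ← sum_inner, hz, inner_zero_left]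
      have h2 : ∀ a, (p a).toReal * ‖z a + ∑ i, z (b i)‖ ^ 2 = (p a).toReal * ‖z a‖ ^ 2 +
          2 * ((p a).toReal * inner ℝ (z a) (∑ i, z (b i))) +
            (p a).toReal * ‖∑ i, z (b i)‖ ^ 2 := fun a => by
        rw [norm_add_sq_real]
        ring
      simp only [Fin.sum_univ_succ, Fin.cons_zero, Fin.cons_succ, h2, Finset.sum_add_distrib,
        ← Finset.mul_sum, h0, ← Finset.sum_mul, MDP.sum_toReal_pmf]
      ring
    simp only [h1, mul_add, Finset.sum_add_distrib, ← Finset.sum_mul, MDP.sum_toReal_pmf, ih]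
    push_cast
    ring

theorem sum_toReal_mul_norm_sub_mean_sq_le (g : α → E) :
    ∑ a, (p a).toReal * ‖g a - ∑ a', (p a').toReal • g a'‖ ^ 2 ≤
      ∑ a, (p a).toReal * ‖g a‖ ^ 2 := by
  set μ := ∑ a', (p a').toReal • g a' with hμ
  have h0 : ∑ a, (p a).toReal * inner ℝ (g a) μ = ‖μ‖ ^ 2 := by
    simp only [← real_inner_smul_left, ← sum_inner, ← hμ, real_inner_self_eq_norm_sq]
  have h2 : ∀ a, (p a).toReal * ‖g a - μ‖ ^ 2 = (p a).toReal * ‖g a‖ ^ 2 -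
      2 * ((p a).toReal * inner ℝ (g a) μ) + (p a).toReal * ‖μ‖ ^ 2 := fun a => by
    rw [norm_sub_sq_real]
    ring
  simp only [h2, Finset.sum_add_distrib, Finset.sum_sub_distrib, ← Finset.mul_sum, h0,
    ← Finset.sum_mul, MDP.sum_toReal_pmf]
  linarith [sq_nonneg ‖μ‖]

/-- One step of ascent along a batch estimate with mean `d` of the direction `G`. -/
theorem ascent_step_le_sum_iidLaw {f : E → ℝ} {θ G r : E} {L η V : ℝ} (hL : 0 ≤ L)
    (hf : ∀ v, |f (θ + v) - f θ - inner ℝ G v| ≤ L / 2 * ‖v‖ ^ 2) (g : α → E)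
    (hV : ∑ a, (p a).toReal * ‖g a‖ ^ 2 ≤ V) {m : ℕ} (hm : 1 ≤ m) {d : E}
    (hd : d = ∑ a, (p a).toReal • g a + r) :
    f θ + η * inner ℝ G d - L / 2 * η ^ 2 * (‖d‖ ^ 2 + V / m) ≤
      ∑ b : Fin m → α, (iidLaw p m b).toReal *
        f (θ + η • ((1 / (m : ℝ)) • ∑ i, g (b i) + r)) := by
  have hm0 : (0 : ℝ) < m := by exact_mod_cast hm
  set μ := ∑ a, (p a).toReal • g a with hμ
  set N : (Fin m → α) → E := fun b => ∑ i, (g (b i) - μ) with hN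
  have hz : ∑ a, (p a).toReal • (g a - μ) = 0 := by
    simp only [smul_sub, Finset.sum_sub_distrib, ← hμ, ← Finset.sum_smul, MDP.sum_toReal_pmf,
      one_smul, sub_self]
  have hbatch : ∀ b : Fin m → α, (1 / (m : ℝ)) • ∑ i, g (b i) + r = d + (1 / (m : ℝ)) • N b :=
    fun b => by
      rw [hd, hN]
      simp only [Finset.sum_sub_distrib, Finset.sum_const, Finset.card_univ, Fintype.card_fin,
        smul_sub]
      rw [← Nat.cast_smul_eq_nsmul ℝ, smul_smul, one_div_mul_cancel hm0.ne', one_smul]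
      abel
  have hmean : ∀ w : E, ∑ b, (iidLaw p m b).toReal * inner ℝ w (N b) = 0 := fun w => by
    simp only [← real_inner_smul_right, ← inner_sum, hN, sum_iidLaw_smul_sum_eq_zero p hz m,
      inner_zero_right]
  have hvar : ∑ b, (iidLaw p m b).toReal * ‖N b‖ ^ 2 ≤ m * V := by
    rw [hN, sum_iidLaw_mul_norm_sq_sum p hz m]
    exact mul_le_mul_of_nonneg_left ((sum_toReal_mul_norm_sub_mean_sq_le p g).trans hV) hm0.le
  -- The quadratic lower bound is expanded so that the terms linear in the noise `N` stand apart;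
  -- they average to zero, and only the variance remains.
  have hpt : ∀ b : Fin m → α, (iidLaw p m b).toReal *
      (f θ + η * inner ℝ G d - L / 2 * η ^ 2 * ‖d‖ ^ 2) +
      η / m * ((iidLaw p m b).toReal * inner ℝ G (N b)) -
      L * η ^ 2 / m * ((iidLaw p m b).toReal * inner ℝ d (N b)) -
      L / 2 * η ^ 2 / m ^ 2 * ((iidLaw p m b).toReal * ‖N b‖ ^ 2) ≤
      (iidLaw p m b).toReal * f (θ + η • ((1 / (m : ℝ)) • ∑ i, g (b i) + r)) := fun b => by
    rw [hbatch]
    have h := (abs_le.1 (hf (η • (d + (1 / (m : ℝ)) • N b)))).1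
    rw [norm_smul, mul_pow, norm_add_sq_real, norm_smul, mul_pow, real_inner_smul_right G,
      inner_add_right, real_inner_smul_right, real_inner_smul_right, Real.norm_eq_abs,
      Real.norm_eq_abs, sq_abs, sq_abs] at h
    refine le_trans (le_of_eq ?_) (mul_le_mul_of_nonneg_left
      (show f θ + η * (inner ℝ G d + 1 / m * inner ℝ G (N b)) - L / 2 * (η ^ 2 * (‖d‖ ^ 2 +
        2 * (1 / m * inner ℝ d (N b)) + (1 / m) ^ 2 * ‖N b‖ ^ 2)) ≤ _ by linarith)
      ENNReal.toReal_nonneg)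
    field_simp
    ring
  have hsum := Finset.sum_le_sum fun b (_ : b ∈ Finset.univ) => hpt b
  refine le_trans ?_ hsum
  simp only [Finset.sum_sub_distrib, Finset.sum_add_distrib, ← Finset.mul_sum, ← Finset.sum_mul,
    hmean, MDP.sum_toReal_pmf]
  have h3 := mul_le_mul_of_nonneg_left hvar (show 0 ≤ L / 2 * η ^ 2 / m ^ 2 by positivity)
  have h4 : L / 2 * η ^ 2 / m ^ 2 * (m * V) = L / 2 * η ^ 2 * (V / m) := by
    field_simp
  linarith

end Batch

/-! ### Telescoping along the iterates -/

namespace PMF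

theorem tsum_pure_mul {α : Type*} (a : α) (g : α → ENNReal) : ∑' x, PMF.pure a x * g x = g a := by
  classical
  rw [tsum_eq_single a]
  · simp
  · intro b hb
    simp [hb]

theorem tsum_bind_mul {α β : Type*} (p : PMF α) (f : α → PMF β) (g : β → ENNReal) :
    ∑' y, p.bind f y * g y = ∑' x, p x * ∑' y, f x y * g y := by
  simp only [PMF.bind_apply, ← ENNReal.tsum_mul_right, ← ENNReal.tsum_mul_left]
  rw [ENNReal.tsum_comm]
  simp only [mul_assoc]

theorem tsum_map_mul {α β : Type*} (p : PMF α) (f : α → β) (g : β → ENNReal) :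
    ∑' y, p.map f y * g y = ∑' x, p x * g (f x) := by
  rw [← PMF.bind_pure_comp, tsum_bind_mul]
  simp only [Function.comp_apply, tsum_pure_mul]

theorem toOuterMeasure_le_one {α : Type*} (p : PMF α) (s : Set α) : p.toOuterMeasure s ≤ 1 := by
  rw [PMF.toOuterMeasure_apply, ← p.tsum_coe]
  exact ENNReal.tsum_le_tsum fun x => Set.indicator_le_self s p x

/-- Markov's inequality for the complement of `s`, phrased through the success probability. -/
theorem mul_one_sub_toOuterMeasure_le {α : Type*} (p : PMF α) (s : Set α) (h : α → ENNReal)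
    (c : ENNReal) (hc : ∀ x ∉ s, c ≤ h x) :
    c * (1 - p.toOuterMeasure s) ≤ ∑' x, p x * h x := by
  have h1 : 1 - p.toOuterMeasure s ≤ ∑' x, sᶜ.indicator p x := by
    rw [tsub_le_iff_left, PMF.toOuterMeasure_apply, ← ENNReal.tsum_add, ← p.tsum_coe]
    exact ENNReal.tsum_le_tsum fun x => (congrFun (Set.indicator_self_add_compl s p) x).ge
  refine (mul_le_mul_right h1 c).trans ?_
  rw [← ENNReal.tsum_mul_left]
  refine ENNReal.tsum_le_tsum fun x => ?_
  by_cases hx : x ∈ s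
  · simp [hx]
  · rw [Set.indicator_of_mem (show x ∈ sᶜ from hx), mul_comm]
    exact mul_le_mul_right (hc x hx) _

end PMF

theorem logBarrier_nonpos {S A : Type u} [Fintype S] [Fintype A] [Nonempty A] {lam : ℝ}
    (hlam : 0 ≤ lam) (θ : Param S A) : logBarrier lam θ ≤ 0 :=
  mul_nonpos_of_nonneg_of_nonpos (by positivity) <| Finset.sum_nonpos fun s _ =>
    Finset.sum_nonpos fun a _ => Real.log_nonpos (softmax_pos θ s a).le (softmax_le_one θ s a)

namespace MDP

/-- A bound for the distance between the gradient of the expected return for rewards of size at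
most `B` and the gradient of the return over the first `H` steps. -/
def truncBias {S A : Type u} (M : MDP S A) (B : ℝ) (H : ℕ) : ℝ :=
  B * (M.γ ^ H * (1 / (1 - M.γ) ^ 2 + H * (1 - M.γ)⁻¹))

section PolicyGradient

variable {S A : Type u} [Fintype S] [Fintype A]
  [MeasurableSpace S] [MeasurableSingletonClass S]
  [MeasurableSpace A] [MeasurableSingletonClass A]
  [Nonempty A] (M : MDP S A)

theorem bddAbove_barrierObj {lam : ℝ} (hlam : 0 ≤ lam) :
    BddAbove (Set.range fun θ : Param S A => M.barrierObj lam θ) := by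
  obtain ⟨B, hB⟩ := exists_abs_le fun x : S × A => M.R x.1 x.2
  refine ⟨B / (1 - M.γ) + 0 + lam * Real.log (Fintype.card A), ?_⟩
  rintro _ ⟨θ, rfl⟩
  exact add_le_add (add_le_add ((le_abs_self _).trans (M.abs_J_le _ fun s a => hB (s, a)))
    (logBarrier_nonpos hlam θ)) le_rfl

theorem barrierGap_nonneg {lam : ℝ} (hlam : 0 ≤ lam) (θ : Param S A) : 0 ≤ M.barrierGap lam θ :=
  sub_nonneg.2 (le_ciSup (M.bddAbove_barrierObj hlam) θ)

/-- Only half of `ν` is used: the barrier gradient is deterministic and adds no variance, so the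
`λ²` term is slack. -/
theorem pathExp_norm_sq_trajGrad_le {B lam : ℝ} (hB : ∀ s a, |M.R s a| ≤ B) (e : Estimator)
    (θ : Param S A) (H : ℕ) :
    M.pathExp (softmaxPolicy θ) H (fun τ => ‖M.trajGrad e θ τ‖ ^ 2) ≤
      nuConst e B M.γ lam (Fintype.card S) (Fintype.card A) H / 2 := by
  have hG : 0 ≤ 1 - 1 / (Fintype.card A : ℝ) := by
    have : (1 : ℝ) ≤ Fintype.card A := by exact_mod_cast Fintype.card_pos
    rw [sub_nonneg, div_le_one (by linarith)]
    exact this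
  have h2 : 0 ≤ (1 - 1 / (Fintype.card A : ℝ)) * (lam ^ 2 / Fintype.card S) := by positivity
  cases e with
  | reinforce =>
    have h := M.pathExp_norm_sq_reinforce_le hB θ H
    rw [nuConst]
    linarith
  | gpomdp =>
    have h := M.pathExp_norm_sq_gpomdp_le hB θ H
    rw [nuConst]
    linarith

/-- One-step descent of the gap. The inner product of the true gradient with the mean `d` of the
estimate is split by polarisation, which leaves half the squared gradient minus half the squared
bias. -/
theorem sum_iidLaw_gap_le {B lam L η ν : ℝ} {e : Estimator} {m H : ℕ}
    (hB : ∀ s a, |M.R s a| ≤ B) (hlam : 0 ≤ lam)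
    (hL : L = smoothConst B M.γ lam (Fintype.card S) (Fintype.card A)) (hL0 : 0 ≤ L)
    (hν : ν = nuConst e B M.γ lam (Fintype.card S) (Fintype.card A) H)
    (hη : 0 ≤ η) (hηL : L * η ≤ 1) (hm : 1 ≤ m) (θ : Param S A) :
    ∑ b, (iidLaw (M.truncLaw (softmaxPolicy θ) H) m b).toReal *
        M.barrierGap lam (θ + η • M.barrierGradEst e lam θ b) + η / 2 * ‖M.objGrad lam θ‖ ^ 2 ≤
      M.barrierGap lam θ + η / 2 * (M.truncBias B H ^ 2 + L * η * ν / (2 * m)) := by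
  set d := M.truncRetGrad H θ + barrierGrad lam θ with hd
  have h1 := ascent_step_le_sum_iidLaw (M.truncLaw (softmaxPolicy θ) H) (f := M.barrierObj lam)
    (η := η) hL0 (fun v => hL ▸ M.abs_barrierObj_sub_sub_le hB hlam θ v)
    (fun τ => M.trajGrad e θ τ) (V := ν / 2) (hν ▸ M.pathExp_norm_sq_trajGrad_le hB e θ H) hm
    (d := d) (r := barrierGrad lam θ) (by rw [hd, ← M.pathExp_trajGrad e θ H]; rfl)
  have h2 : ∑ b, (iidLaw (M.truncLaw (softmaxPolicy θ) H) m b).toReal *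
      M.barrierGap lam (θ + η • M.barrierGradEst e lam θ b) =
      (⨆ θ, M.barrierObj lam θ) - ∑ b, (iidLaw (M.truncLaw (softmaxPolicy θ) H) m b).toReal *
        M.barrierObj lam (θ + η • M.barrierGradEst e lam θ b) := by
    simp only [barrierGap, mul_sub, Finset.sum_sub_distrib, ← Finset.sum_mul, sum_toReal_pmf,
      one_mul]
  rw [h2, barrierGap]
  have h3 : ‖M.objGrad lam θ - d‖ ^ 2 ≤ M.truncBias B H ^ 2 := by
    refine pow_le_pow_left₀ (norm_nonneg _) ?_ 2
    rw [hd, objGrad, add_sub_add_right_eq_sub]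
    exact M.norm_retGrad_sub_truncRetGrad_le hB H θ
  rw [norm_sub_sq_real] at h3
  -- The term `‖d‖²` from polarisation absorbs the curvature term exactly when `L η ≤ 1`.
  have h4 : L / 2 * η ^ 2 * ‖d‖ ^ 2 ≤ η / 2 * ‖d‖ ^ 2 := by
    refine mul_le_mul_of_nonneg_right ?_ (sq_nonneg _)
    nlinarith
  have h5 : L / 2 * η ^ 2 * (ν / 2 / m) = η / 2 * (L * η * ν / (2 * m)) := by
    field_simp
  have h6 := mul_le_mul_of_nonneg_left h3 (div_nonneg hη two_pos.le)
  have h7 : ∀ b : Fin m → Fin H → S × A, M.barrierGradEst e lam θ b =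
      (1 / (m : ℝ)) • ∑ i, M.trajGrad e θ (b i) + barrierGrad lam θ := fun b => rfl
  simp only [h7]
  linarith

theorem sum_one_sub_successProb_le {B lam L η ν ε εopt : ℝ} {e : Estimator} {m H : ℕ}
    (hB : ∀ s a, |M.R s a| ≤ B) (hlam : 0 ≤ lam)
    (hL : L = smoothConst B M.γ lam (Fintype.card S) (Fintype.card A)) (hL0 : 0 ≤ L)
    (hν : ν = nuConst e B M.γ lam (Fintype.card S) (Fintype.card A) H) (hν0 : 0 ≤ ν)
    (hη : 0 ≤ η) (hηL : L * η ≤ 1) (hm : 1 ≤ m) (hεopt : 0 ≤ εopt)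
    (hstat : ∀ θ, ‖M.objGrad lam θ‖ ≤ εopt → M.Jstar - M.J (softmaxPolicy θ) ≤ ε)
    (θ₀ : Param S A) (T : ℕ) :
    η / 2 * εopt ^ 2 * ∑ t ∈ Finset.range T, (1 - M.successProb e lam η m H θ₀ ε t) ≤
      M.barrierGap lam θ₀ + T * (η / 2 * (M.truncBias B H ^ 2 + L * η * ν / (2 * m))) := by
  set c := η / 2 * (M.truncBias B H ^ 2 + L * η * ν / (2 * m)) with hc
  have hc0 : 0 ≤ c := by positivity
  -- The gap and the squared gradient are nonnegative, so expectations over the iterates can be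
  -- taken in `ENNReal` without summability conditions.
  set V : Param S A → ENNReal := fun θ => ENNReal.ofReal (M.barrierGap lam θ) with hV
  set h : Param S A → ENNReal := fun θ => ENNReal.ofReal (η / 2 * ‖M.objGrad lam θ‖ ^ 2) with hh
  set p := M.pgLaw e lam η m H θ₀ with hp
  have hgap := M.barrierGap_nonneg (S := S) (A := A) hlam
  have hpt : ∀ θ, ∑' b, iidLaw (M.truncLaw (softmaxPolicy θ) H) m b *
      V (θ + η • M.barrierGradEst e lam θ b) + h θ ≤ V θ + ENNReal.ofReal c := fun θ => by
    have h1 : ∑' b, iidLaw (M.truncLaw (softmaxPolicy θ) H) m b *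
        V (θ + η • M.barrierGradEst e lam θ b) = ENNReal.ofReal
        (∑ b, (iidLaw (M.truncLaw (softmaxPolicy θ) H) m b).toReal *
          M.barrierGap lam (θ + η • M.barrierGradEst e lam θ b)) := by
      rw [tsum_fintype, ENNReal.ofReal_sum_of_nonneg fun b _ =>
        mul_nonneg ENNReal.toReal_nonneg (hgap _)]
      refine Finset.sum_congr rfl fun b _ => ?_
      rw [ENNReal.ofReal_mul ENNReal.toReal_nonneg, ENNReal.ofReal_toReal (PMF.apply_ne_top _ _)]
    rw [h1, hh, hV, ← ENNReal.ofReal_add (Finset.sum_nonneg fun b _ =>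
        mul_nonneg ENNReal.toReal_nonneg (hgap _)) (by positivity),
      ← ENNReal.ofReal_add (hgap _) hc0]
    exact ENNReal.ofReal_le_ofReal
      (M.sum_iidLaw_gap_le hB hlam hL hL0 hν hη hηL hm θ)
  have hstep : ∀ t, ∑' θ, p (t + 1) θ * V θ + ∑' θ, p t θ * h θ ≤
      ∑' θ, p t θ * V θ + ENNReal.ofReal c := fun t => by
    have e1 : ∑' θ, p (t + 1) θ * V θ = ∑' θ, p t θ *
        ∑' b, iidLaw (M.truncLaw (softmaxPolicy θ) H) m b *
          V (θ + η • M.barrierGradEst e lam θ b) := by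
      rw [hp, pgLaw, PMF.tsum_bind_mul]
      simp only [PMF.tsum_map_mul]
    rw [e1, ← ENNReal.tsum_add]
    refine (ENNReal.tsum_le_tsum fun θ => ?_).trans_eq (b := ∑' θ, (p t θ * V θ +
      p t θ * ENNReal.ofReal c)) ?_
    · rw [← mul_add, ← mul_add]
      exact mul_le_mul_right (hpt θ) _
    · rw [ENNReal.tsum_add, ENNReal.tsum_mul_right, PMF.tsum_coe, one_mul]
  have htot : ∀ T : ℕ, ∑' θ, p T θ * V θ + ∑ t ∈ Finset.range T, ∑' θ, p t θ * h θ ≤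
      V θ₀ + T * ENNReal.ofReal c := fun T => by
    induction T with
    | zero =>
      rw [hp, pgLaw, PMF.tsum_pure_mul]
      simp
    | succ T ih =>
      rw [Finset.sum_range_succ, add_comm (∑ t ∈ _, _), ← add_assoc]
      refine (add_le_add_left (hstep T) _).trans ?_
      rw [add_right_comm]
      refine (add_le_add_left ih _).trans_eq ?_
      push_cast
      ring
  have hmarkov : ∀ t, ENNReal.ofReal (η / 2 * εopt ^ 2 *
      (1 - M.successProb e lam η m H θ₀ ε t)) ≤ ∑' θ, p t θ * h θ := fun t => by
    refine le_trans (le_of_eq ?_) ((p t).mul_one_sub_toOuterMeasure_le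
      {θ | M.Jstar - M.J (softmaxPolicy θ) ≤ ε} h (ENNReal.ofReal (η / 2 * εopt ^ 2))
      fun θ hθ => ENNReal.ofReal_le_ofReal ?_)
    · have hle := (p t).toOuterMeasure_le_one {θ | M.Jstar - M.J (softmaxPolicy θ) ≤ ε}
      rw [ENNReal.ofReal_mul (by positivity), successProb, ENNReal.ofReal_sub _
        ENNReal.toReal_nonneg, ENNReal.ofReal_one,
        ENNReal.ofReal_toReal (ne_top_of_le_ne_top ENNReal.one_ne_top hle)]
    · refine mul_le_mul_of_nonneg_left (pow_le_pow_left₀ hεopt ?_ 2) (by positivity)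
      -- A failing iterate has gradient norm above `εopt`, by the contrapositive of `hstat`.
      by_contra hlt
      exact hθ (hstat θ (not_le.1 hlt).le)
  have hle : ∀ t, 0 ≤ 1 - M.successProb e lam η m H θ₀ ε t := fun t => by
    rw [sub_nonneg, successProb, ← ENNReal.toReal_one]
    exact ENNReal.toReal_mono ENNReal.one_ne_top (PMF.toOuterMeasure_le_one _ _)
  rw [Finset.mul_sum, ← ENNReal.ofReal_le_ofReal_iff (add_nonneg (hgap _) (by positivity)),
    ENNReal.ofReal_sum_of_nonneg fun t _ => mul_nonneg (by positivity) (hle t)]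
  refine (Finset.sum_le_sum fun t _ => hmarkov t).trans (le_add_self.trans ((htot T).trans_eq ?_))
  rw [ENNReal.ofReal_add (hgap _) (by positivity), ENNReal.ofReal_mul (Nat.cast_nonneg T),
    ENNReal.ofReal_natCast]

theorem exactPG_sum_le {B lam L : ℝ} (hB : ∀ s a, |M.R s a| ≤ B) (hlam : 0 ≤ lam)
    (hL : L = smoothConst B M.γ lam (Fintype.card S) (Fintype.card A)) (hL0 : 0 < L)
    (θ₀ : Param S A) (T : ℕ) :
    ∑ t ∈ Finset.range T, ‖M.objGrad lam (M.exactPG lam (1 / L) θ₀ t)‖ ^ 2 ≤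
      2 * L * M.barrierGap lam θ₀ := by
  have hstep : ∀ θ : Param S A, 1 / (2 * L) * ‖M.objGrad lam θ‖ ^ 2 ≤
      M.barrierGap lam θ - M.barrierGap lam (θ + (1 / L) • M.objGrad lam θ) := fun θ => by
    have h := (abs_le.1 (M.abs_barrierObj_sub_sub_le hB hlam θ ((1 / L) • M.objGrad lam θ))).1
    rw [← hL, norm_smul, real_inner_smul_right, real_inner_self_eq_norm_sq, mul_pow,
      Real.norm_eq_abs, sq_abs] at h
    have e1 : L / 2 * ((1 / L) ^ 2 * ‖M.objGrad lam θ‖ ^ 2) =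
        1 / (2 * L) * ‖M.objGrad lam θ‖ ^ 2 := by
      field_simp
    have e2 : 1 / L * ‖M.objGrad lam θ‖ ^ 2 = 2 * (1 / (2 * L) * ‖M.objGrad lam θ‖ ^ 2) := by
      field_simp
    rw [barrierGap, barrierGap]
    linarith
  have htot : ∀ T : ℕ, 1 / (2 * L) *
      ∑ t ∈ Finset.range T, ‖M.objGrad lam (M.exactPG lam (1 / L) θ₀ t)‖ ^ 2 ≤
      M.barrierGap lam θ₀ - M.barrierGap lam (M.exactPG lam (1 / L) θ₀ T) := fun T => by
    induction T with
    | zero => simp [exactPG]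
    | succ T ih =>
      rw [Finset.sum_range_succ, mul_add, exactPG, gradient_barrierObj _ hlam]
      linarith [hstep (M.exactPG lam (1 / L) θ₀ T)]
  have h := (htot T).trans (sub_le_self _ (M.barrierGap_nonneg hlam _))
  rw [one_div_mul_eq_div, div_le_iff₀ (by positivity)] at h
  linarith

end PolicyGradient


/-! ### Performance difference and near-stationary points -/

section PerformanceDifference

variable {S A : Type u} [Fintype S] [Fintype A]

/-- Fixed point of the Bellman operator, a `γ`-contraction in the sup norm. Only this equation is
used; `V` is never identified with a conditional expected return. -/
theorem exists_bellman_eq (M : MDP S A) (π : S → PMF A) :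
    ∃ V : S → ℝ, ∀ s, V s = ∑ a, (π s a).toReal *
      (M.R s a + M.γ * ∑ s', (M.P s a s').toReal * V s') := by
  set f : (S → ℝ) → S → ℝ := fun V s => ∑ a, (π s a).toReal *
    (M.R s a + M.γ * ∑ s', (M.P s a s').toReal * V s') with hf
  have hlip : LipschitzWith ⟨M.γ, M.γ_nonneg⟩ f := by
    refine LipschitzWith.of_dist_le_mul fun V W => ?_
    have hd := mul_nonneg M.γ_nonneg (dist_nonneg (x := V) (y := W))
    refine (dist_pi_le_iff hd).2 fun s => ?_
    have e : f V s - f W s = ∑ a, (π s a).toReal *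
        (M.γ * ∑ s', (M.P s a s').toReal * (V s' - W s')) := by
      simp only [hf, ← Finset.sum_sub_distrib, ← mul_sub, add_sub_add_left_eq_sub]
    rw [Real.dist_eq, e]
    refine (Finset.abs_sum_le_sum_abs _ _).trans ((Finset.sum_le_sum
      (g := fun a => (π s a).toReal * (M.γ * dist V W)) fun a _ => ?_).trans_eq ?_)
    · rw [abs_mul, abs_mul, abs_of_nonneg ENNReal.toReal_nonneg, abs_of_nonneg M.γ_nonneg]
      refine mul_le_mul_of_nonneg_left (mul_le_mul_of_nonneg_left ?_ M.γ_nonneg)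
        ENNReal.toReal_nonneg
      refine (Finset.abs_sum_le_sum_abs _ _).trans ((Finset.sum_le_sum
        (g := fun s' => (M.P s a s').toReal * dist V W) fun s' _ => ?_).trans_eq ?_)
      · rw [abs_mul, abs_of_nonneg ENNReal.toReal_nonneg, ← Real.dist_eq]
        exact mul_le_mul_of_nonneg_left (dist_le_pi_dist V W s') ENNReal.toReal_nonneg
      · rw [← Finset.sum_mul, sum_toReal_pmf, one_mul]
    · rw [← Finset.sum_mul, sum_toReal_pmf, one_mul]
  have hc : ContractingWith ⟨M.γ, M.γ_nonneg⟩ f := ⟨M.γ_lt_one, hlip⟩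
  exact ⟨hc.fixedPoint, fun s => (congrFun hc.fixedPoint_isFixedPt s).symm⟩

variable [MeasurableSpace S] [MeasurableSingletonClass S]
  [MeasurableSpace A] [MeasurableSingletonClass A] (M : MDP S A)

section Step

variable (π : S → PMF A) (t : ℕ)

theorem stepExp_add (f g : S × A → ℝ) :
    M.stepExp π t (fun x => f x + g x) = M.stepExp π t f + M.stepExp π t g :=
  M.pathExp_add π _ _

theorem stepExp_mul (c : ℝ) (f : S × A → ℝ) :
    M.stepExp π t (fun x => c * f x) = c * M.stepExp π t f :=
  M.pathExp_mul π c _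

theorem stepExp_sum {ι : Type*} (s : Finset ι) (f : ι → S × A → ℝ) :
    M.stepExp π t (fun x => ∑ i ∈ s, f i x) = ∑ i ∈ s, M.stepExp π t (f i) :=
  M.pathExp_sum π s _

theorem stepExp_mono {f g : S × A → ℝ} (h : ∀ x, f x ≤ g x) :
    M.stepExp π t f ≤ M.stepExp π t g :=
  M.pathExp_mono π fun _ => h _

theorem stepExp_eq_action_mean (f : S × A → ℝ) :
    M.stepExp π t f = M.stepExp π t fun x => ∑ a, (π x.1 a).toReal * f (x.1, a) := by
  rw [stepExp, stepExp, pathExp_succ, pathExp_succ]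
  simp only [Fin.snoc_last, smul_eq_mul, ← Finset.sum_mul, sum_toReal_pmf, one_mul]

theorem stepExp_succ_fst (g : S → ℝ) :
    M.stepExp π (t + 1) (fun x => g x.1) =
      M.stepExp π t fun x => ∑ s, (M.P x.1 x.2 s).toReal * g s := by
  rw [stepExp_succ]
  simp only [← Finset.sum_mul, sum_toReal_pmf, one_mul]

end Step

variable (π : S → PMF A)

/-- The expected discounted number of visits to a state. -/
def occupation (s : S) : ℝ := M.visitation π s / (1 - M.γ)

theorem occupation_eq_tsum [DecidableEq S] (s : S) :
    M.occupation π s = ∑' t, M.γ ^ t * M.stepExp π t fun x => if x.1 = s then 1 else 0 := by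
  rw [occupation, visitation_eq_tsum, mul_div_cancel_left₀ _ (sub_pos.2 M.γ_lt_one).ne']

/-- An occupation is a return with indicator reward, so its differentiability in `θ` is a case of
`hasGradientAt_J`. -/
theorem occupation_eq_J [DecidableEq S] (s : S) :
    M.occupation π s = (M.withReward fun s' _ => if s' = s then 1 else 0).J π := by
  rw [occupation_eq_tsum, J_withReward]

theorem stepExp_indicator_nonneg [DecidableEq S] (t : ℕ) (s : S) :
    0 ≤ M.stepExp π t fun x => if x.1 = s then 1 else 0 := by
  refine le_trans (le_of_eq ?_) (M.stepExp_mono π t (f := fun _ => 0) fun x => ?_)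
  · exact (M.pathExp_zero_right π).symm
  · split_ifs <;> norm_num

theorem rho_le_occupation (s : S) : (M.ρ s).toReal ≤ M.occupation π s := by
  classical
  rw [occupation_eq_tsum]
  refine le_trans (le_of_eq ?_) ((M.summable_stepExp π fun x => if x.1 = s then 1 else 0).le_tsum 0
    fun t _ => mul_nonneg (pow_nonneg M.γ_nonneg t) (M.stepExp_indicator_nonneg π t s))
  rw [stepExp_zero]
  simp [sum_toReal_pmf]

theorem tsum_stepExp_fst (g : S → ℝ) :
    ∑' t, M.γ ^ t * M.stepExp π t (fun x => g x.1) = ∑ s, M.occupation π s * g s := by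
  classical
  have h : ∀ t, M.γ ^ t * M.stepExp π t (fun x => g x.1) =
      ∑ s, M.γ ^ t * M.stepExp π t (fun x => if x.1 = s then 1 else 0) * g s := fun t => by
    have hg : (fun x : S × A => g x.1) = fun x => ∑ s, g s * if x.1 = s then 1 else 0 := by
      funext x
      simp
    rw [hg, stepExp_sum, Finset.mul_sum]
    refine Finset.sum_congr rfl fun s _ => ?_
    rw [stepExp_mul]
    ring
  simp only [h]
  rw [Summable.tsum_finsetSum fun s _ => (M.summable_stepExp π _).mul_right _]
  refine Finset.sum_congr rfl fun s _ => ?_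
  rw [tsum_mul_right, ← occupation_eq_tsum]

theorem sum_occupation : ∑ s, M.occupation π s = (1 - M.γ)⁻¹ := by
  have h := M.tsum_stepExp_fst π fun _ => 1
  simp only [mul_one] at h
  rw [← h, ← tsum_geometric_of_lt_one M.γ_nonneg M.γ_lt_one]
  refine tsum_congr fun t => ?_
  rw [stepExp, pathExp_const, mul_one]

/-- The performance difference lemma. -/
theorem exists_advantage : ∃ adv : S → A → ℝ, (∀ s, ∑ a, (π s a).toReal * adv s a = 0) ∧
    ∀ π' : S → PMF A, M.J π' - M.J π =
      ∑ s, M.occupation π' s * ∑ a, (π' s a).toReal * adv s a := by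
  obtain ⟨V, hV⟩ := M.exists_bellman_eq π
  set adv : S → A → ℝ := fun s a =>
    M.R s a + M.γ * ∑ s', (M.P s a s').toReal * V s' - V s with hadv
  have h0 : ∀ s, ∑ a, (π s a).toReal * adv s a = 0 := fun s => by
    simp only [hadv, mul_sub, Finset.sum_sub_distrib, ← Finset.sum_mul, sum_toReal_pmf, one_mul]
    rw [sub_eq_zero]
    exact (hV s).symm
  have key : ∀ π' : S → PMF A, M.J π' = ∑ s, (M.ρ s).toReal * V s +
      ∑ s, M.occupation π' s * ∑ a, (π' s a).toReal * adv s a := fun π' => by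
    -- The reward is the advantage plus `V - γ P V`; the discounted means of `V` telescope over `t`
    -- and leave only its mean under `ρ`.
    have hstep : ∀ t, M.γ ^ t * M.stepExp π' t (fun x => M.R x.1 x.2) =
        M.γ ^ t * M.stepExp π' t (fun x => ∑ a, (π' x.1 a).toReal * adv x.1 a) +
        (M.γ ^ t * M.stepExp π' t (fun x => V x.1) -
          M.γ ^ (t + 1) * M.stepExp π' (t + 1) (fun x => V x.1)) := fun t => by
      have hR : (fun x : S × A => M.R x.1 x.2) = fun x => adv x.1 x.2 +
          (V x.1 + -M.γ * ∑ s', (M.P x.1 x.2 s').toReal * V s') := by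
        funext x
        simp only [hadv]
        ring
      rw [hR, stepExp_add, stepExp_add, stepExp_mul, ← stepExp_succ_fst,
        M.stepExp_eq_action_mean π' t fun x => adv x.1 x.2]
      ring
    have hs1 := M.summable_stepExp π' fun x => ∑ a, (π' x.1 a).toReal * adv x.1 a
    have hs2 := M.summable_stepExp π' fun x => V x.1
    have hs3 := (summable_nat_add_iff 1).2 hs2
    rw [J_eq_tsum, tsum_congr hstep, hs1.tsum_add (hs2.sub hs3), hs2.tsum_sub hs3,
      hs2.tsum_eq_zero_add, add_sub_cancel_right, stepExp_zero,
      M.tsum_stepExp_fst π' fun s => ∑ a, (π' s a).toReal * adv s a]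
    simp only [← Finset.sum_mul, sum_toReal_pmf, one_mul, pow_zero]
    ring
  refine ⟨adv, h0, fun π' => ?_⟩
  -- For `π` itself the advantages average to zero, so `J π` is the mean of `V` under `ρ`.
  rw [key π', key π]
  simp only [h0, mul_zero, Finset.sum_const_zero, add_zero, add_sub_cancel_left]

theorem visitation_le_mismatch_mul (hρ : ∀ s, 0 < M.ρ s) (s : S) :
    M.visitation π s ≤ M.mismatch π * (M.ρ s).toReal := by
  have h := le_ciSup (f := fun s => M.visitation π s / (M.ρ s).toReal)
    (Set.finite_range _).bddAbove s
  exact (div_le_iff₀ (ENNReal.toReal_pos (hρ s).ne' (M.ρ.apply_ne_top s))).1 h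

/-- The visitation distribution and `ρ` both have total mass one, so their ratio cannot stay below
one. -/
theorem one_le_mismatch (hρ : ∀ s, 0 < M.ρ s) : 1 ≤ M.mismatch π := by
  have hγ := sub_pos.2 M.γ_lt_one
  have h1 : ∑ s, M.visitation π s = 1 := by
    have h := M.sum_occupation π
    simp only [occupation, ← Finset.sum_div] at h
    rwa [div_eq_iff hγ.ne', inv_mul_cancel₀ hγ.ne'] at h
  have h := Finset.sum_le_sum fun s (_ : s ∈ Finset.univ) => M.visitation_le_mismatch_mul π hρ s
  rwa [h1, ← Finset.mul_sum, sum_toReal_pmf, mul_one] at h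

variable [Nonempty A]

/-- The policy gradient theorem for the softmax parametrisation. -/
theorem retGrad_apply (θ : Param S A) {adv : S → A → ℝ}
    (h0 : ∀ s, ∑ a, softmax θ s a * adv s a = 0)
    (hdiff : ∀ θ' : Param S A, M.J (softmaxPolicy θ') - M.J (softmaxPolicy θ) =
      ∑ s, M.occupation (softmaxPolicy θ') s * ∑ a, softmax θ' s a * adv s a) (s : S) (a : A) :
    M.retGrad θ (s, a) =
      M.occupation (softmaxPolicy θ) s * (softmax θ s a * adv s a) := by
  classical
  set v : Param S A := EuclideanSpace.single (s, a) (1 : ℝ) with hv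
  have hline : HasDerivAt (fun y : ℝ => θ + y • v) v 0 := by
    simpa using ((hasDerivAt_id (0 : ℝ)).smul_const v).const_add θ
  have hJ : ∀ N : MDP S A, HasDerivAt (fun y : ℝ => N.J (softmaxPolicy (θ + y • v)))
      (inner ℝ (N.retGrad θ) v) 0 := fun N => by
    have h := (N.hasGradientAt_J θ).hasFDerivAt
    rw [← add_zero θ, ← zero_smul ℝ v] at h
    have h2 := h.comp_hasDerivAt 0 hline
    rw [InnerProductSpace.toDual_apply_apply, zero_smul, add_zero] at h2
    exact h2
  have h1 := (hJ M).sub_const (M.J (softmaxPolicy θ))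
  simp only [hdiff] at h1
  -- The product rule also differentiates the occupation, but that derivative is multiplied by the
  -- mean advantage at `θ`, which is zero.
  have h2 := HasDerivAt.fun_sum fun (s' : S) (_ : s' ∈ Finset.univ) =>
    (hJ (M.withReward fun s'' _ => if s'' = s' then 1 else 0)).mul
      (HasDerivAt.fun_sum fun (a' : A) (_ : a' ∈ Finset.univ) =>
        (hasDerivAt_softmax_line θ v s' a' 0).mul_const (adv s' a'))
  simp only [← occupation_eq_J] at h2
  have h3 := h1.unique h2
  simp only [zero_smul, add_zero, h0, mul_zero, zero_add] at h3
  rw [hv] at h3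
  simp only [EuclideanSpace.inner_single_right, one_mul, conj_trivial, score_apply] at h3
  rw [h3, Finset.sum_eq_single s]
  · congr 1
    simp only [if_true, mul_sub, sub_mul, Finset.sum_sub_distrib, mul_ite, ite_mul, mul_one,
      mul_zero, zero_mul, Finset.sum_ite_eq, Finset.mem_univ]
    rw [sub_eq_self]
    simp only [mul_right_comm _ (softmax θ s a), ← Finset.sum_mul, h0, zero_mul]
  · intro s' _ hs
    simp [hs.symm]
  · simp

/-- In coordinate `(s, a)` the constant part of the barrier gradient equals the tolerance, so both
cancel. What remains is proportional to `π_θ(a ∣ s)`, which divides out and bounds the advantage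
even for very unlikely actions. -/
theorem J_sub_J_le_of_norm_objGrad_le (hρ : ∀ s, 0 < M.ρ s) {lam : ℝ} (hlam : 0 ≤ lam)
    {θ : Param S A} (hθ : ‖M.objGrad lam θ‖ ≤ lam / (Fintype.card A * Fintype.card S)) :
    M.J π - M.J (softmaxPolicy θ) ≤ lam * M.mismatch π / (1 - M.γ) := by
  have hγ := sub_pos.2 M.γ_lt_one
  have hA : (0 : ℝ) < Fintype.card A := by exact_mod_cast Fintype.card_pos
  obtain ⟨s₀, -⟩ := M.ρ.support_nonempty
  have hS : (0 : ℝ) < Fintype.card S := by exact_mod_cast Fintype.card_pos_iff.2 ⟨s₀⟩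
  obtain ⟨adv, h0, hdiff⟩ := M.exists_advantage (softmaxPolicy θ)
  have hgrad := M.retGrad_apply θ (adv := adv) (by simpa only [toReal_softmaxPolicy] using h0)
    fun θ' => by simpa only [toReal_softmaxPolicy] using hdiff (softmaxPolicy θ')
  have hρ' : ∀ s, 0 < (M.ρ s).toReal := fun s =>
    ENNReal.toReal_pos (hρ s).ne' (M.ρ.apply_ne_top s)
  have hadv : ∀ s a, adv s a ≤ lam / (Fintype.card S * (M.ρ s).toReal) := fun s a => by
    rcases le_or_gt (adv s a) 0 with h | h
    · exact h.trans (div_nonneg hlam (mul_pos hS (hρ' s)).le)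
    have h1 : M.objGrad lam θ (s, a) ≤ lam / (Fintype.card A * Fintype.card S) :=
      (le_abs_self _).trans ((PiLp.norm_apply_le (M.objGrad lam θ) (s, a)).trans hθ)
    rw [objGrad, PiLp.add_apply, hgrad, barrierGrad_apply] at h1
    have h2 : lam / (Fintype.card A * Fintype.card S) * (1 - Fintype.card A * softmax θ s a) =
        lam / (Fintype.card A * Fintype.card S) - lam / Fintype.card S * softmax θ s a := by
      field_simp
    have h3 : M.occupation (softmaxPolicy θ) s * adv s a ≤ lam / Fintype.card S := by
      refine le_of_mul_le_mul_right ?_ (softmax_pos θ s a)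
      linarith
    -- The occupation is at least `ρ s`, the term of time zero; positivity of `ρ` therefore prevents
    -- it from masking the advantage.
    have h4 := (mul_le_mul_of_nonneg_right (M.rho_le_occupation (softmaxPolicy θ) s) h.le).trans h3
    rw [le_div_iff₀ (mul_pos hS (hρ' s))]
    rw [le_div_iff₀ hS] at h4
    linarith
  rw [hdiff π]
  refine (Finset.sum_le_sum (g := fun _ => M.mismatch π / (1 - M.γ) * (lam / Fintype.card S))
    fun s _ => ?_).trans_eq ?_
  · have h1 : ∑ a, (π s a).toReal * adv s a ≤ lam / (Fintype.card S * (M.ρ s).toReal) := by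
      refine (Finset.sum_le_sum fun a _ => mul_le_mul_of_nonneg_left (hadv s a)
        ENNReal.toReal_nonneg).trans_eq ?_
      rw [← Finset.sum_mul, sum_toReal_pmf, one_mul]
    refine (mul_le_mul_of_nonneg_left h1 ((hρ' s).le.trans (M.rho_le_occupation π s))).trans ?_
    have h2 : M.occupation π s ≤ M.mismatch π * (M.ρ s).toReal / (1 - M.γ) :=
      div_le_div_of_nonneg_right (M.visitation_le_mismatch_mul π hρ s) hγ.le
    refine (mul_le_mul_of_nonneg_right h2 (div_nonneg hlam (mul_pos hS (hρ' s)).le)).trans_eq ?_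
    have := (hρ' s).ne'
    field_simp
  · rw [Finset.sum_const, Finset.card_univ, nsmul_eq_mul]
    field_simp

end PerformanceDifference

end MDP

/-! ### Bounds on the horizon, the constants and the sample count -/

section Bounds

theorem one_le_log_four_div_add {y εopt : ℝ} (hy : 0 < y) (hy1 : y ≤ 1) (hε : 0 < εopt) :
    1 ≤ Real.log (4 / y + 1 / εopt) := by
  have h4 : 4 ≤ 4 / y := by rw [le_div_iff₀ hy]; linarith
  rw [Real.le_log_iff_exp_le (by positivity)]
  have h1 : 0 < 1 / εopt := by positivity
  linarith [Real.exp_one_lt_d9]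

theorem one_le_log_mul {y εopt δ : ℝ} (hy : 0 < y) (hy1 : y ≤ 1) (hε : 0 < εopt) (hδ : 0 < δ)
    (hδ1 : δ < 1) : 1 ≤ Real.log (4 / y + 1 / εopt) * (1 + Real.log (1 / δ)) := by
  have h1 := one_le_log_four_div_add hy hy1 hε
  have h2 : 0 ≤ Real.log (1 / δ) := Real.log_nonneg (by rw [le_div_iff₀ hδ]; linarith)
  nlinarith

/-- The coefficient `6 + B²` is spent as follows: `X⁶` pays for `y⁴` and `εopt²`, the factor `exp
(-B²)` pays for `B²`, and the term `log (1/δ)` pays for `δ`. -/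
theorem exp_neg_le_of_horizon {B y εopt δ x : ℝ} (hy : 0 < y) (hy1 : y ≤ 1)
    (hε : 0 < εopt) (hδ : 0 < δ) (hδ1 : δ < 1)
    (hx : (6 + B ^ 2) * (Real.log (4 / y + 1 / εopt) * (1 + Real.log (1 / δ))) ≤ x) :
    4 * B ^ 2 * Real.exp (-x) ≤ δ * εopt ^ 2 / 4 * y ^ 4 := by
  set X := 4 / y + 1 / εopt with hX
  have hX0 : 0 < X := by positivity
  have hl := one_le_log_four_div_add hy hy1 hε
  rw [← hX] at hl
  have hd : 0 ≤ Real.log (1 / δ) := Real.log_nonneg (by rw [le_div_iff₀ hδ]; linarith)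
  have hBl : B ^ 2 ≤ B ^ 2 * Real.log X := le_mul_of_one_le_right (sq_nonneg B) hl
  have hdl : Real.log (1 / δ) ≤ (6 + B ^ 2) * Real.log X * Real.log (1 / δ) :=
    le_mul_of_one_le_left hd (by nlinarith [sq_nonneg B])
  have h1 : -x ≤ -(6 * Real.log X) + (-B ^ 2 + Real.log δ) := by
    rw [one_div, Real.log_inv] at hdl hx
    linarith
  have h2 : Real.exp (-x) ≤ (X ^ 6)⁻¹ * (Real.exp (-B ^ 2) * δ) := by
    refine (Real.exp_le_exp.2 h1).trans_eq ?_
    rw [Real.exp_add, Real.exp_add, Real.exp_log hδ, Real.exp_neg, show 6 * Real.log X =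
      ((6 : ℕ) : ℝ) * Real.log X by norm_num, ← Real.log_pow, Real.exp_log (pow_pos hX0 6)]
  have h3 : B ^ 2 * Real.exp (-B ^ 2) ≤ 1 := by
    rw [Real.exp_neg, ← div_eq_mul_inv, div_le_one (Real.exp_pos _)]
    linarith [Real.add_one_le_exp (B ^ 2)]
  have h4 : (4 / y) ^ 4 * (1 / εopt) ^ 2 ≤ X ^ 6 := by
    have e1 : (0 : ℝ) < 4 / y := by positivity
    have e2 : 0 < 1 / εopt := by positivity
    rw [show X ^ 6 = X ^ 4 * X ^ 2 by ring]
    exact mul_le_mul (pow_le_pow_left₀ e1.le (by linarith) 4)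
      (pow_le_pow_left₀ e2.le (by linarith) 2) (by positivity) (by positivity)
  have h5 : (X ^ 6)⁻¹ ≤ y ^ 4 * εopt ^ 2 / 256 := by
    refine (inv_anti₀ (by positivity) h4).trans_eq ?_
    field_simp
    norm_num
  calc 4 * B ^ 2 * Real.exp (-x) ≤ 4 * B ^ 2 * ((X ^ 6)⁻¹ * (Real.exp (-B ^ 2) * δ)) :=
        mul_le_mul_of_nonneg_left h2 (by positivity)
    _ = 4 * δ * (X ^ 6)⁻¹ * (B ^ 2 * Real.exp (-B ^ 2)) := by ring
    _ ≤ 4 * δ * (X ^ 6)⁻¹ * 1 := mul_le_mul_of_nonneg_left h3 (by positivity)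
    _ ≤ 4 * δ * (y ^ 4 * εopt ^ 2 / 256) * 1 := by gcongr
    _ ≤ δ * εopt ^ 2 / 4 * y ^ 4 := by
      have : 0 < δ * εopt ^ 2 * y ^ 4 := by positivity
      linarith

/-- With `x = H (1 - γ)` one has `γ^H ≤ exp (-x)`, and `(1 + x)² ≤ 4 exp x` costs one of the two
factors `exp (-x)` in the squared bias. -/
theorem MDP.truncBias_sq_le {S A : Type u} (M : MDP S A) {B εopt δ : ℝ}
    (hε : 0 < εopt) (hδ : 0 < δ) (hδ1 : δ < 1) {H : ℕ}
    (hH : (6 + B ^ 2) * (Real.log (4 / (1 - M.γ) + 1 / εopt) * (1 + Real.log (1 / δ))) /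
      (1 - M.γ) ≤ H) :
    M.truncBias B H ^ 2 ≤ δ * εopt ^ 2 / 4 := by
  have hγ0 := M.γ_nonneg
  have hy : 0 < 1 - M.γ := sub_pos.2 M.γ_lt_one
  set y := 1 - M.γ with hydef
  have hx := exp_neg_le_of_horizon hy (by linarith) hε hδ hδ1 ((div_le_iff₀ hy).1 hH)
  set x := (H : ℝ) * y with hxdef
  have hpow : M.γ ^ H ≤ Real.exp (-x) := by
    rw [hxdef, ← mul_neg, Real.exp_nat_mul]
    refine pow_le_pow_left₀ hγ0 ?_ H
    linarith [Real.add_one_le_exp (-y)]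
  have hx0 : 0 ≤ x := by positivity
  have h1 : (1 + x) ^ 2 ≤ 4 * Real.exp x := by
    have h := Real.add_one_le_exp (x / 2)
    have h' := pow_le_pow_left₀ (by positivity) h 2
    rw [← Real.exp_nat_mul, show ((2 : ℕ) : ℝ) * (x / 2) = x by push_cast; ring] at h'
    nlinarith [sq_nonneg x]
  have e : M.truncBias B H = B * M.γ ^ H * (1 + x) / y ^ 2 := by
    rw [MDP.truncBias, ← hydef, hxdef]
    field_simp
  rw [e, div_pow, div_le_iff₀ (by positivity)]
  calc (B * M.γ ^ H * (1 + x)) ^ 2 = B ^ 2 * (M.γ ^ H) ^ 2 * (1 + x) ^ 2 := by ring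
    _ ≤ B ^ 2 * Real.exp (-x) ^ 2 * (4 * Real.exp x) := by
      have := pow_nonneg hγ0 H
      gcongr
    _ = 4 * B ^ 2 * Real.exp (-x) * (Real.exp (-x) * Real.exp x) := by ring
    _ = 4 * B ^ 2 * Real.exp (-x) := by
      rw [← Real.exp_add, neg_add_cancel, Real.exp_zero, mul_one]
    _ ≤ δ * εopt ^ 2 / 4 * y ^ 4 := hx
    _ = δ * εopt ^ 2 / 4 * (y ^ 2) ^ 2 := by ring

theorem smoothConst_le {B γ lam nS nA : ℝ} (hB : 0 ≤ B) (hγ0 : 0 ≤ γ) (hγ1 : γ < 1)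
    (hlam0 : 0 ≤ lam) (hlam : lam ≤ 1) (hS : 1 ≤ nS) (hA : 1 ≤ nA) :
    smoothConst B γ lam nS nA ≤ (2 * B + 1) / (1 - γ) ^ 2 := by
  have hy : 0 < 1 - γ := sub_pos.2 hγ1
  have h1 : lam / nS ≤ 1 / (1 - γ) ^ 2 := by
    refine ((div_le_self hlam0 hS).trans hlam).trans ?_
    rw [le_div_iff₀ (by positivity), one_mul]
    exact pow_le_one₀ hy.le (by linarith)
  have h2 : B / (1 - γ) ^ 2 * (2 - 1 / nA) ≤ B / (1 - γ) ^ 2 * 2 := by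
    refine mul_le_mul_of_nonneg_left ?_ (by positivity)
    have : 0 < 1 / nA := by positivity
    linarith
  rw [smoothConst, add_div]
  refine add_le_add (h2.trans_eq (by ring)) h1

theorem smoothConst_pos {B γ lam nS nA : ℝ} (hB : 0 ≤ B) (hlam : 0 < lam) (hS : 1 ≤ nS)
    (hA : 1 ≤ nA) : 0 < smoothConst B γ lam nS nA := by
  have h1 : 0 ≤ B / (1 - γ) ^ 2 * (2 - 1 / nA) := by
    refine mul_nonneg (by positivity) ?_
    have : 1 / nA ≤ 1 := by rw [div_le_one (by linarith)]; exact hA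
    linarith
  have h2 : 0 < lam / nS := by positivity
  rw [smoothConst]
  linarith

theorem nuConst_nonneg {e : Estimator} {B γ lam nS nA : ℝ} {H : ℕ} (hγ1 : γ < 1)
    (hS : 1 ≤ nS) (hA : 1 ≤ nA) : 0 ≤ nuConst e B γ lam nS nA H := by
  have hy : 0 < 1 - γ := sub_pos.2 hγ1
  have h1 : 0 ≤ 1 - 1 / nA := by
    rw [sub_nonneg, div_le_one (by linarith)]
    exact hA
  cases e <;> simp only [nuConst] <;> positivity

theorem nuConst_le {e : Estimator} {B γ lam nS nA c logs : ℝ} {H : ℕ} (hγ0 : 0 ≤ γ)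
    (hγ1 : γ < 1) (hlam0 : 0 ≤ lam) (hlam : lam ≤ 1) (hS : 1 ≤ nS) (hA : 1 ≤ nA)
    (hc : 1 ≤ c) (hlogs : 1 ≤ logs) (hH : (H : ℝ) ≤ c * logs / (1 - γ)) :
    nuConst e B γ lam nS nA H ≤
      2 * (B ^ 2 + 1) * c * logs ^ (e.logExp - 1) / (1 - γ) ^ 3 := by
  have hy : 0 < 1 - γ := sub_pos.2 hγ1
  have hG : 1 - 1 / nA ≤ 1 := by
    have : 0 < 1 / nA := by positivity
    linarith
  have hy3 : 1 ≤ 1 / (1 - γ) ^ 3 := by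
    rw [le_div_iff₀ (by positivity), one_mul]
    exact pow_le_one₀ hy.le (by linarith)
  have hl : lam ^ 2 / nS ≤ 1 / (1 - γ) ^ 3 :=
    ((div_le_self (sq_nonneg _) hS).trans (pow_le_one₀ hlam0 hlam)).trans hy3
  cases e with
  | reinforce =>
    have h1 : H * B ^ 2 / (1 - γ) ^ 2 ≤ B ^ 2 * (c * logs / (1 - γ) ^ 3) := by
      refine (div_le_div_of_nonneg_right (mul_le_mul_of_nonneg_right hH (sq_nonneg B))
        (by positivity)).trans_eq ?_
      field_simp
    have h2 : lam ^ 2 / nS ≤ c * logs / (1 - γ) ^ 3 :=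
      hl.trans (div_le_div_of_nonneg_right (by nlinarith) (by positivity))
    have h3 : 0 ≤ H * B ^ 2 / (1 - γ) ^ 2 + lam ^ 2 / nS := by positivity
    simp only [nuConst, Estimator.logExp]
    calc 2 * (1 - 1 / nA) * (H * B ^ 2 / (1 - γ) ^ 2 + lam ^ 2 / nS) ≤
        2 * 1 * (H * B ^ 2 / (1 - γ) ^ 2 + lam ^ 2 / nS) := by gcongr
      _ ≤ 2 * 1 * (B ^ 2 * (c * logs / (1 - γ) ^ 3) + c * logs / (1 - γ) ^ 3) := by gcongr
      _ = 2 * (B ^ 2 + 1) * c * logs ^ (2 - 1) / (1 - γ) ^ 3 := by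
        rw [show 2 - 1 = 1 from rfl, pow_one]
        ring
  | gpomdp =>
    have h3 : 0 ≤ B ^ 2 / (1 - γ) ^ 3 + lam ^ 2 / nS := by positivity
    simp only [nuConst, Estimator.logExp]
    calc 2 * (1 - 1 / nA) * (B ^ 2 / (1 - γ) ^ 3 + lam ^ 2 / nS) ≤
        2 * 1 * (B ^ 2 / (1 - γ) ^ 3 + lam ^ 2 / nS) := by gcongr
      _ ≤ 2 * 1 * (B ^ 2 / (1 - γ) ^ 3 + 1 / (1 - γ) ^ 3) := by gcongr
      _ = 2 * (B ^ 2 + 1) * 1 * logs ^ (1 - 1) / (1 - γ) ^ 3 := by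
        rw [show 1 - 1 = 0 from rfl, pow_zero]
        ring
      _ ≤ 2 * (B ^ 2 + 1) * c * logs ^ (1 - 1) / (1 - γ) ^ 3 := by gcongr

/-- Rounding `T` up costs at most one extra batch, and the upper limit on `m` keeps it below the
main term: `2080 = 8 · 4⁴ + 2 · 4²`. The power `y⁶` combines `y²` from `L`, `y³` from `ν` and `y`
from `H`. -/
theorem samples_le {gap L ν δ εopt Z y m T H w logs l N c : ℝ} (hδ : 0 < δ) (hδ1 : δ < 1)
    (hy : 0 < y) (hy1 : y ≤ 1) (hZ : 1 ≤ Z) (hε : εopt = 1 / (4 * Z)) (hgap : 0 ≤ gap)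
    (hL0 : 0 ≤ L) (hL : L ≤ l / y ^ 2) (hl : 1 ≤ l) (hν0 : 0 ≤ ν) (hν : ν ≤ N * w / y ^ 3)
    (hm : 0 < m) (hmν : m ≤ 2 * ν / (δ * εopt ^ 2))
    (hT : T ≤ 8 * gap * L * ν / (δ ^ 2 * εopt ^ 4 * m) + 1) (hH0 : 0 ≤ H)
    (hH : H ≤ c * logs / y) :
    T * m * H ≤ 2080 * l * N * c * (1 + gap) * (Z ^ 4 / (δ ^ 2 * y ^ 6)) * (w * logs) := by
  have hε0 : 0 < εopt := by rw [hε]; positivity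
  have hP : 0 ≤ N * w / y ^ 3 := hν0.trans hν
  have h1 : T * m ≤ 8 * gap * L * ν / (δ ^ 2 * εopt ^ 4) + m := by
    refine (mul_le_mul_of_nonneg_right hT hm.le).trans_eq ?_
    field_simp
  have h2 : 8 * gap * L * ν / (δ ^ 2 * εopt ^ 4) ≤
      2048 * (gap * l) * ((N * w / y ^ 3) * (Z ^ 4 / (δ ^ 2 * y ^ 2))) := by
    calc 8 * gap * L * ν / (δ ^ 2 * εopt ^ 4) = 2048 * gap * L * ν * Z ^ 4 / δ ^ 2 := by
          rw [hε]
          field_simp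
          ring
      _ ≤ 2048 * gap * (l / y ^ 2) * (N * w / y ^ 3) * Z ^ 4 / δ ^ 2 := by gcongr
      _ = _ := by field_simp
  have h3 : 2 * ν / (δ * εopt ^ 2) ≤ 32 * ((N * w / y ^ 3) * (Z ^ 4 / (δ ^ 2 * y ^ 2))) := by
    calc 2 * ν / (δ * εopt ^ 2) = 32 * (ν * (Z ^ 2 / δ)) := by
          rw [hε]
          field_simp
          ring
      _ ≤ 32 * ((N * w / y ^ 3) * (Z ^ 4 / (δ ^ 2 * y ^ 2))) := by
          have a1 : Z ^ 2 ≤ Z ^ 4 := pow_le_pow_right₀ hZ (by norm_num)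
          have a2 : δ ^ 2 * y ^ 2 ≤ δ := by
            have b1 : y ^ 2 ≤ 1 := pow_le_one₀ hy.le hy1
            have b2 : δ ^ 2 ≤ δ := by nlinarith
            nlinarith [sq_nonneg δ, sq_nonneg y]
          gcongr
  set Q := (N * w / y ^ 3) * (Z ^ 4 / (δ ^ 2 * y ^ 2)) with hQ
  have hQ0 : 0 ≤ Q := by positivity
  have h4 : T * m ≤ 2080 * l * (1 + gap) * Q := by
    have b1 : 1 ≤ l * (1 + gap) := by nlinarith
    have b2 := mul_le_mul_of_nonneg_right b1 hQ0
    have b3 : gap * l * Q ≤ l * (1 + gap) * Q := by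
      refine mul_le_mul_of_nonneg_right ?_ hQ0
      nlinarith
    linarith
  calc T * m * H ≤ 2080 * l * (1 + gap) * Q * H := mul_le_mul_of_nonneg_right h4 hH0
    _ ≤ 2080 * l * (1 + gap) * Q * (c * logs / y) :=
      mul_le_mul_of_nonneg_left hH (by positivity)
    _ = _ := by
      rw [hQ]
      field_simp

end Bounds

/-! ### Guarantees for vanilla and exact policy gradient -/

namespace MDP

section Guarantees

variable {S A : Type u} [Fintype S] [Fintype A]
  [MeasurableSpace S] [MeasurableSingletonClass S]
  [MeasurableSpace A] [MeasurableSingletonClass A]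
  [Nonempty A] (M : MDP S A)

theorem average_successProb_ge {B lam L η ν ε εopt δ : ℝ} {e : Estimator} {m H T : ℕ}
    (hB : ∀ s a, |M.R s a| ≤ B) (hlam : 0 ≤ lam)
    (hL : L = smoothConst B M.γ lam (Fintype.card S) (Fintype.card A)) (hL0 : 0 < L)
    (hν : ν = nuConst e B M.γ lam (Fintype.card S) (Fintype.card A) H)
    (hεopt : 0 < εopt) (hδ : 0 < δ) (hm : 1 ≤ m)
    (hbias : M.truncBias B H ^ 2 ≤ δ * εopt ^ 2 / 4)
    (hstat : ∀ θ, ‖M.objGrad lam θ‖ ≤ εopt → M.Jstar - M.J (softmaxPolicy θ) ≤ ε)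
    (θ₀ : Param S A) (hmν : (m : ℝ) ≤ 2 * ν / (δ * εopt ^ 2)) (hT : 1 ≤ T)
    (hTm : 8 * M.barrierGap lam θ₀ * L * ν / (δ ^ 2 * εopt ^ 4) ≤ (T : ℝ) * m)
    (hη : η = δ * εopt ^ 2 * m / (2 * L * ν)) :
    1 - δ ≤ (1 / (T : ℝ)) * ∑ t ∈ Finset.range T, M.successProb e lam η m H θ₀ ε t := by
  have hm0 : (0 : ℝ) < m := by exact_mod_cast hm
  have hT0 : (0 : ℝ) < T := by exact_mod_cast hT
  have hmν' : m * (δ * εopt ^ 2) ≤ 2 * ν := (le_div_iff₀ (by positivity)).1 hmν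
  have hν0 : 0 < ν := by
    have : 0 < m * (δ * εopt ^ 2) := by positivity
    linarith
  have hη0 : 0 < η := by rw [hη]; positivity
  -- This is the role of the upper limit on the batch size; `ν > 0` also follows from it, as `m ≥
  -- 1`.
  have hηL : L * η ≤ 1 := by
    rw [hη, mul_div_assoc', div_le_one (by positivity)]
    nlinarith
  have h := M.sum_one_sub_successProb_le (e := e) hB hlam hL hL0.le hν hν0.le hη0.le hηL hm
    hεopt.le hstat θ₀ T
  -- The step size is tuned so that noise takes a quarter of the budget `δ εopt²`, as much as
  -- `hbias` grants to the bias; the initial gap takes the remaining half.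
  have hnoise : L * η * ν / (2 * m) = δ * εopt ^ 2 / 4 := by
    rw [hη]
    field_simp
    ring
  have hgap : M.barrierGap lam θ₀ ≤ T * (η / 2 * (δ * εopt ^ 2 / 2)) := by
    rw [div_le_iff₀ (by positivity)] at hTm
    have e1 : (T : ℝ) * (η / 2 * (δ * εopt ^ 2 / 2)) =
        T * m * (δ ^ 2 * εopt ^ 4) / (8 * L * ν) := by
      rw [hη]
      field_simp
      ring
    rw [e1, le_div_iff₀ (by positivity)]
    linarith
  have hbound : T * (η / 2 * (M.truncBias B H ^ 2 + L * η * ν / (2 * m))) ≤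
      T * (η / 2 * (δ * εopt ^ 2 / 2)) := by
    rw [hnoise]
    gcongr
    linarith
  have hfinal : η / 2 * εopt ^ 2 *
      ∑ t ∈ Finset.range T, (1 - M.successProb e lam η m H θ₀ ε t) ≤
      η / 2 * εopt ^ 2 * (T * δ) := by linarith
  have hsum := le_of_mul_le_mul_left hfinal (by positivity)
  rw [Finset.sum_sub_distrib, Finset.sum_const, Finset.card_range, nsmul_one] at hsum
  rw [one_div_mul_eq_div, le_div_iff₀ hT0]
  linarith

theorem exists_exactPG_norm_objGrad_le {B lam L εopt : ℝ} (hB : ∀ s a, |M.R s a| ≤ B)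
    (hlam : 0 ≤ lam) (hL : L = smoothConst B M.γ lam (Fintype.card S) (Fintype.card A))
    (hL0 : 0 < L) (hεopt : 0 < εopt) (θ₀ : Param S A) {T : ℕ} (hT : 1 ≤ T)
    (hTL : 12 * M.barrierGap lam θ₀ * L / εopt ^ 2 ≤ T) :
    ∃ t < T, ‖M.objGrad lam (M.exactPG lam (1 / L) θ₀ t)‖ ≤ εopt := by
  have h := M.exactPG_sum_le hB hlam hL hL0 θ₀ T
  have hgap := mul_nonneg hL0.le (M.barrierGap_nonneg hlam θ₀)
  rw [div_le_iff₀ (by positivity)] at hTL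
  -- Averaging needs only `2 · gap · L ≤ T εopt²`; the constant 12 leaves room.
  obtain ⟨t, ht, hle⟩ := Finset.exists_le_of_sum_le (s := Finset.range T)
    (g := fun _ => εopt ^ 2) ⟨0, Finset.mem_range.2 hT⟩ (h.trans (by
      rw [Finset.sum_const, Finset.card_range, nsmul_eq_mul]
      linarith))
  exact ⟨t, Finset.mem_range.1 ht,
    (pow_le_pow_iff_left₀ (norm_nonneg _) hεopt.le two_ne_zero).1 hle⟩

theorem Jstar_sub_le (hρ : ∀ s, 0 < M.ρ s) {π : S → PMF A} (hπ : M.IsOptimal π) {lam : ℝ}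
    (hlam : 0 ≤ lam) {θ : Param S A}
    (hθ : ‖M.objGrad lam θ‖ ≤ lam / (2 * Fintype.card S * Fintype.card A)) :
    M.Jstar - M.J (softmaxPolicy θ) ≤ lam * M.mismatch π / (1 - M.γ) := by
  have h1 : M.Jstar ≤ M.J π := ciSup_le fun θ => hπ _
  have h2 := M.J_sub_J_le_of_norm_objGrad_le π hρ hlam (hθ.trans (by
    obtain ⟨s₀, -⟩ := M.ρ.support_nonempty
    have hA : (0 : ℝ) < Fintype.card A := by exact_mod_cast Fintype.card_pos
    have hS : (0 : ℝ) < Fintype.card S := by exact_mod_cast Fintype.card_pos_iff.2 ⟨s₀⟩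
    refine div_le_div_of_nonneg_left hlam (by positivity) ?_
    nlinarith [mul_pos hA hS]))
  linarith

end Guarantees

end MDP

end

theorem mainTheorem11 (Rmax : ℝ) :
    ∃ C > (0 : ℝ), ∃ K > (0 : ℝ),
      ∀ (S A : Type u) [Fintype S] [Fintype A] [Nonempty A]
        [MeasurableSpace S] [MeasurableSingletonClass S]
        [MeasurableSpace A] [MeasurableSingletonClass A]
        (M : MDP S A), (∀ s a, |M.R s a| ≤ Rmax) → (∀ s, 0 < M.ρ s) →
      ∀ πstar : S → PMF A, M.IsOptimal πstar →
      ∀ (θ₀ : Param S A) (ε : ℝ), 0 < ε →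
      ∀ nS nA D lam εopt L gap : ℝ,
        nS = Fintype.card S →
        nA = Fintype.card A →
        D = M.mismatch πstar →
        lam = (1 - M.γ) * ε / (2 * D) →
        εopt = lam / (2 * nS * nA) →
        L = smoothConst Rmax M.γ lam nS nA →
        gap = M.barrierGap lam θ₀ →
        -- vanilla policy gradient
        (∀ (e : Estimator) (δ : ℝ), 0 < δ → δ < 1 →
          ∀ (ν : ℕ → ℝ) (logs : ℝ),
          ν = nuConst e Rmax M.γ lam nS nA →
          logs = Real.log (4 / (1 - M.γ) + 1 / εopt) * (1 + Real.log (1 / δ)) →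
          -- every admissible choice of parameters succeeds
          (∀ (H m T : ℕ) (η : ℝ),
            C * logs / (1 - M.γ) ≤ H →
            1 ≤ m → (m : ℝ) ≤ 2 * ν H / (δ * εopt ^ 2) →
            1 ≤ T → 8 * gap * L * ν H / (δ ^ 2 * εopt ^ 4) ≤ (T : ℝ) * m →
            η = δ * εopt ^ 2 * m / (2 * L * ν H) →
            1 - δ ≤ (1 / (T : ℝ)) *
                ∑ t ∈ Finset.range T, M.successProb e lam η m H θ₀ ε t ∧
              ∃ t < T, 1 - δ ≤ M.successProb e lam η m H θ₀ ε t) ∧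
          -- the range of batch sizes is not empty as soon as there is a choice of actions
          (2 ≤ Fintype.card A → ∀ H : ℕ, 1 ≤ 2 * ν H / (δ * εopt ^ 2)) ∧
          -- the number of samples for the least admissible `H` and `T`
          (ε ≤ 1 / (1 - M.γ) → ∀ H m T : ℕ,
            H = ⌈C * logs / (1 - M.γ)⌉₊ →
            1 ≤ m → (m : ℝ) ≤ 2 * ν H / (δ * εopt ^ 2) →
            T = max 1 ⌈8 * gap * L * ν H / (δ ^ 2 * εopt ^ 4 * m)⌉₊ →
            (T : ℝ) * m * H ≤
              K * (1 + gap) * (nS ^ 4 * nA ^ 4 * D ^ 4 / (δ ^ 2 * ε ^ 4 * (1 - M.γ) ^ 10)) *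
                logs ^ e.logExp)) ∧
        -- exact policy gradient with step size `1 / L`
        (∀ T : ℕ, 1 ≤ T → 12 * gap * L / εopt ^ 2 ≤ T →
          ∃ t < T, M.Jstar - M.J (softmaxPolicy (M.exactPG lam (1 / L) θ₀ t)) ≤ ε) ∧
        (ε ≤ 1 / (1 - M.γ) →
          12 * gap * L / εopt ^ 2 ≤
            K * gap * (nS ^ 2 * nA ^ 2 * D ^ 2) / ((1 - M.γ) ^ 4 * ε ^ 2)) := by
  -- `K` is the product in `samples_le` with `l = 2 |Rmax| + 1`, `N = 2 (Rmax² + 1)(7 + Rmax²)` and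
  -- `c = 7 + Rmax²`. The absolute value makes `K` positive before an MDP forces `Rmax ≥ 0`.
  refine ⟨6 + Rmax ^ 2, by positivity,
    2080 * (2 * |Rmax| + 1) * (2 * (Rmax ^ 2 + 1) * (7 + Rmax ^ 2)) * (7 + Rmax ^ 2),
    by positivity, ?_⟩
  intro S A _ _ _ _ _ _ _ M hR hρ πstar hopt θ₀ ε hε nS nA D lam εopt L gap hnS hnA hD hlam hεopt
    hL hgap
  have hB0 := M.nonneg_of_abs_reward_le hR
  have hγ0 := M.γ_nonneg
  have hγ1 := M.γ_lt_one
  have hy : 0 < 1 - M.γ := sub_pos.2 hγ1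
  have hy1 : 1 - M.γ ≤ 1 := by linarith
  obtain ⟨s₀, -⟩ := M.ρ.support_nonempty
  have hA1 : 1 ≤ nA := by
    rw [hnA]
    exact_mod_cast Fintype.card_pos (α := A)
  have hS1 : 1 ≤ nS := by
    rw [hnS]
    exact_mod_cast Fintype.card_pos_iff.2 ⟨s₀⟩
  have hD1 : 1 ≤ D := hD ▸ M.one_le_mismatch πstar hρ
  have hlam0 : 0 < lam := by rw [hlam]; positivity
  have hεopt0 : 0 < εopt := by rw [hεopt]; positivity
  have hL0 : 0 < L := hL ▸ smoothConst_pos hB0 hlam0 hS1 hA1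
  have hgap0 : 0 ≤ gap := hgap ▸ M.barrierGap_nonneg hlam0.le θ₀
  have hLc : L = smoothConst Rmax M.γ lam (Fintype.card S) (Fintype.card A) := by
    rw [hL, hnS, hnA]
  have hstat : ∀ θ, ‖M.objGrad lam θ‖ ≤ εopt → M.Jstar - M.J (softmaxPolicy θ) ≤ ε :=
    fun θ hθ => by
      refine (M.Jstar_sub_le hρ hopt hlam0.le (by rwa [← hnS, ← hnA, ← hεopt])).trans ?_
      rw [← hD, hlam]
      have : (1 - M.γ) * ε / (2 * D) * D / (1 - M.γ) = ε / 2 := by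
        field_simp
      linarith
  -- All accuracy parameters enter the counts through `Z`; its fourth power supplies the last four
  -- factors `(1 - γ)⁻¹` of the sample complexity.
  set Z := nS * nA * D / ((1 - M.γ) * ε) with hZ
  have hεZ : εopt = 1 / (4 * Z) := by
    rw [hεopt, hlam, hZ]
    field_simp
    norm_num
  have hsmall : ε ≤ 1 / (1 - M.γ) → lam ≤ 1 ∧ 1 ≤ Z := fun h => by
    rw [le_div_iff₀ hy, mul_comm] at h
    constructor
    · rw [hlam, div_le_one (by positivity)]
      linarith
    · rw [hZ, le_div_iff₀ (by positivity), one_mul]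
      exact h.trans (one_le_mul_of_one_le_of_one_le (one_le_mul_of_one_le_of_one_le hS1 hA1) hD1)
  refine ⟨fun e δ hδ hδ1 ν logs hν hlogs => ⟨?_, ?_, ?_⟩, ?_, ?_⟩
  · intro H m T η hH hm hmν hT hTm hη
    have hνc : ν H = nuConst e Rmax M.γ lam (Fintype.card S) (Fintype.card A) H := by
      rw [hν, hnS, hnA]
    have hbias := M.truncBias_sq_le hεopt0 hδ hδ1 (hlogs ▸ hH)
    have h := M.average_successProb_ge hR hlam0.le hLc hL0 hνc hεopt0 hδ hm hbias hstat θ₀ hmν hT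
      (hgap ▸ hTm) hη
    refine ⟨h, ?_⟩
    have hT0 : (0 : ℝ) < T := by exact_mod_cast hT
    rw [one_div_mul_eq_div, le_div_iff₀ hT0] at h
    obtain ⟨t, ht, hle⟩ := Finset.exists_le_of_sum_le (s := Finset.range T)
      (f := fun _ => 1 - δ) ⟨0, Finset.mem_range.2 hT⟩ (le_trans (le_of_eq (by
        rw [Finset.sum_const, Finset.card_range, nsmul_eq_mul, mul_comm])) h)
    exact ⟨t, Finset.mem_range.1 ht, hle⟩
  · intro hcard H
    have hA2 : 2 ≤ nA := by
      rw [hnA]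
      exact_mod_cast hcard
    have hinv : 1 / nA ≤ 1 / 2 := one_div_le_one_div_of_le two_pos hA2
    -- With two actions `2 (1 - 1/|A|) ≥ 1`, so the barrier term of `ν` alone dominates `εopt²`,
    -- whatever the rewards and `H`.
    have hν1 : lam ^ 2 / nS ≤ ν H := by
      have h0 : 0 ≤ lam ^ 2 / nS := by positivity
      have hle : ∀ x : ℝ, 0 ≤ x → lam ^ 2 / nS ≤ 2 * (1 - 1 / nA) * (x + lam ^ 2 / nS) :=
        fun x hx => by nlinarith
      rw [hν]
      cases e <;> exact hle _ (by positivity)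
    rw [le_div_iff₀ (by positivity), one_mul]
    have h1 : δ * εopt ^ 2 ≤ εopt ^ 2 := mul_le_of_le_one_left (sq_nonneg _) hδ1.le
    have h2 : εopt ^ 2 ≤ lam ^ 2 / nS := by
      rw [hεopt, div_pow]
      refine div_le_div_of_nonneg_left (sq_nonneg _) (by positivity) ?_
      nlinarith [mul_le_mul hS1 hA1 zero_le_one (by linarith), mul_pos (lt_of_lt_of_le one_pos hS1)
        (lt_of_lt_of_le one_pos hA1)]
    have h3 : 0 ≤ lam ^ 2 / nS := by positivity
    linarith
  · intro hεle H m T hH hm hmν hT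
    obtain ⟨hlam1, hZ1⟩ := hsmall hεle
    have hlogs1 : 1 ≤ logs := hlogs ▸ one_le_log_mul hy hy1 hεopt0 hδ hδ1
    have hm0 : (0 : ℝ) < m := by exact_mod_cast hm
    -- Rounding `H` up costs 1, which is at most `logs / (1 - γ)`; hence 7 in place of 6.
    have hHle : (H : ℝ) ≤ (7 + Rmax ^ 2) * logs / (1 - M.γ) := by
      have h1 : (H : ℝ) < (6 + Rmax ^ 2) * logs / (1 - M.γ) + 1 := by
        rw [hH]
        exact Nat.ceil_lt_add_one (by positivity)
      have h2 : 1 ≤ logs / (1 - M.γ) := by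
        rw [le_div_iff₀ hy]
        linarith
      have h3 : (7 + Rmax ^ 2) * logs / (1 - M.γ) =
          (6 + Rmax ^ 2) * logs / (1 - M.γ) + logs / (1 - M.γ) := by ring
      linarith
    have hν0 : 0 ≤ ν H := hν ▸ nuConst_nonneg hγ1 hS1 hA1
    have hνle : ν H ≤ 2 * (Rmax ^ 2 + 1) * (7 + Rmax ^ 2) * logs ^ (e.logExp - 1) /
        (1 - M.γ) ^ 3 := by
      rw [hν]
      exact nuConst_le hγ0 hγ1 hlam0.le hlam1 hS1 hA1 (by nlinarith [sq_nonneg Rmax]) hlogs1 hHle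
    have hTle : (T : ℝ) ≤ 8 * gap * L * ν H / (δ ^ 2 * εopt ^ 4 * m) + 1 := by
      have h0 : 0 ≤ 8 * gap * L * ν H / (δ ^ 2 * εopt ^ 4 * m) := by positivity
      rw [hT, Nat.cast_max, Nat.cast_one]
      exact max_le (by linarith) (Nat.ceil_lt_add_one h0).le
    have h := samples_le hδ hδ1 hy hy1 hZ1 hεZ hgap0 hL0.le
      (hL ▸ smoothConst_le hB0 hγ0 hγ1 hlam0.le hlam1 hS1 hA1) (by linarith) hν0 hνle hm0 hmν hTle
      (Nat.cast_nonneg H) hHle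
    rw [abs_of_nonneg hB0]
    refine h.trans_eq ?_
    have hpow : logs ^ (e.logExp - 1) * logs = logs ^ e.logExp := by
      rw [← pow_succ]
      cases e <;> rfl
    rw [hpow, hZ]
    congr 2
    field_simp
  · intro T hT hTL
    obtain ⟨t, ht, hle⟩ := M.exists_exactPG_norm_objGrad_le hR hlam0.le hLc hL0 hεopt0 θ₀ hT
      (hgap ▸ hTL)
    exact ⟨t, ht, hstat _ hle⟩
  · intro hεle
    obtain ⟨hlam1, hZ1⟩ := hsmall hεle
    have hLle : L ≤ (2 * Rmax + 1) / (1 - M.γ) ^ 2 :=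
      hL ▸ smoothConst_le hB0 hγ0 hγ1 hlam0.le hlam1 hS1 hA1
    rw [abs_of_nonneg hB0]
    calc 12 * gap * L / εopt ^ 2 = 192 * gap * L * Z ^ 2 := by
          rw [hεZ]
          field_simp
          ring
      _ ≤ 192 * gap * ((2 * Rmax + 1) / (1 - M.γ) ^ 2) * Z ^ 2 := by gcongr
      _ = 192 * (2 * Rmax + 1) * gap * (nS ^ 2 * nA ^ 2 * D ^ 2) / ((1 - M.γ) ^ 4 * ε ^ 2) := by
          rw [hZ]
          field_simp
      _ ≤ _ := by
          have h1 : 1 ≤ 2 * (Rmax ^ 2 + 1) := by linarith [sq_nonneg Rmax]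
          have h2 : 1 ≤ 7 + Rmax ^ 2 := by linarith [sq_nonneg Rmax]
          have h3 : 192 * (2 * Rmax + 1) ≤ 2080 * (2 * Rmax + 1) := by linarith
          have h4 := h3.trans ((le_mul_of_one_le_right (by positivity)
            (one_le_mul_of_one_le_of_one_le h1 h2)).trans
            (le_mul_of_one_le_right (by positivity) h2))
          exact div_le_div_of_nonneg_right (mul_le_mul_of_nonneg_right
            (mul_le_mul_of_nonneg_right h4 hgap0) (by positivity)) (by positivity)
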